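/- All graphs are finite and simple. For graphs $F$ and $G$ and a positive integer $n$, let $ex_F(n,G)$ denote the maximum number of pairwise edge-disjoint copies of $F$ on a common set of $n$ vertices such that no copy of $G$ on these vertices has all of its edges coming from pairwise distinct copies of $F$ of the family. Here a copy of a graph is a (not necessarily induced) subgraph, of the complete graph on the $n$ vertices, that is isomorphic to it. Let $\chi$ denote the chromatic number and $e(F)$ the number of edges of $F$. Let $F$ and $G$ be finite simple graphs such that $F$ has at least one edge and $\chi(G)\ge 3$. Then $$ex_F(n,G)=\frac{\chi(G)-2}{2\,e(F)\,(\chi(G)-1)}\,n^2+o(n^2)\qquad(n\to\infty)$$ if and only if $\chi(G)>\chi(F)$. -/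

import Mathlib

open Filter Asymptotics

namespace SimpleGraph

/-- A family `P` of subgraphs of the complete graph on `Fin n` is an `F`-packing: every member is
a copy of `F` (a not necessarily induced subgraph isomorphic to `F`), and distinct members are
edge-disjoint. -/
def IsEdgeDisjointCopies {V : Type*} (F : SimpleGraph V) {n : ℕ}
    (P : Finset (⊤ : SimpleGraph (Fin n)).Subgraph) : Prop :=
  (∀ A ∈ P, Nonempty (F ≃g A.coe)) ∧
    ∀ A ∈ P, ∀ B ∈ P, A ≠ B → Disjoint A.edgeSet B.edgeSet

/-- A family `P` of subgraphs of the complete graph on `Fin n`, each regarded as a colour class,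
contains a rainbow copy of `G`: there is a copy of `G` on the vertex set `Fin n`, embedded by `φ`,
whose edges come from pairwise distinct members of `P` (the edge `e` from the member `c e`). -/
def HasRainbowCopy {W : Type*} (G : SimpleGraph W) {n : ℕ}
    (P : Finset (⊤ : SimpleGraph (Fin n)).Subgraph) : Prop :=
  ∃ (φ : W ↪ Fin n) (c : G.edgeSet → (⊤ : SimpleGraph (Fin n)).Subgraph),
    Function.Injective c ∧
      ∀ e : G.edgeSet, c e ∈ P ∧ Sym2.map φ (e : Sym2 W) ∈ (c e).edgeSet

/-- The `F`-multicolor Turán number `ex_F(n, G)`: the maximum number of pairwise edge-disjoint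
copies of `F` on `n` vertices without a rainbow copy of `G`. The set below is finite, because
there are finitely many subgraphs of the complete graph on `Fin n`, and it contains `0` as soon
as `G` has an edge, so that the supremum is a maximum. -/
noncomputable def multicolorTuranNumber {V W : Type*} (F : SimpleGraph V) (n : ℕ)
    (G : SimpleGraph W) : ℕ :=
  sSup {m : ℕ | ∃ P : Finset (⊤ : SimpleGraph (Fin n)).Subgraph,
    F.IsEdgeDisjointCopies P ∧ ¬ G.HasRainbowCopy P ∧ P.card = m}

end SimpleGraph

/-! Put p = χ(G) - 1, and let U be the union of a packing of m copies of F, so that U has m·e(F)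
edges.

Upper bound. If U had a positive density of (p+1)-cliques, a positive proportion of vertex systems
would be blow-ups of K_{p+1} in U. An edge of U determines its copy of F, which has boundedly many
vertices, so in some such blow-up no vertex lies in the copy through an edge spanned by two others,
and the copy of G found there is rainbow. Hence U has few (p+1)-cliques
(`IsEdgeDisjointCopies.orderedCliqueCount_lt`). By the stability theorem
`exists_partition_adjCount_add_monoCount_le`, some partition into p classes makes e(U) plus the
number of edges inside classes at most (1 - 1/p + o(1))n²/2. Dropping the inner edges gives the
Turán-type bound. If F is not p-colourable, every copy has an inner edge, so m(e(F)+1) obeys the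
same bound and the asymptotic formula fails.

Lower bound. If F is p-colourable, the complete balanced p-partite graph, which contains no G, is
packed almost perfectly (`card_packing_le_multicolorTuranNumber`). All proper colourings of F are
used together, so that every ordered pair of classes receives the same number N of coloured arcs.
Over a field of prime order Q ≡ 1 mod N, the nonzero elements split into N cosets of a subgroup A;
for each colouring F is placed in the field so that the arcs between two given classes have
differences in distinct cosets. Scaling by A and translating then uses each edge at most once and
misses only a proportion 1/Q. A further coordinate in `ZMod m` lets n grow while Q stays fixed. -/

namespace SimpleGraph

/-! ### Stability for graphs with few cliques -/

section Stability

open Finset Classical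

variable {V : Type*}

/-- The number of ordered `j`-cliques of `U` inside `S`. -/
noncomputable def orderedCliqueCount (U : SimpleGraph V) : ℕ → Finset V → ℕ
  | 0, _ => 1
  | j + 1, S => ∑ x ∈ S, orderedCliqueCount U j {y ∈ S | U.Adj x y}

/-- The number of ordered pairs of adjacent vertices of `U` inside `S`. -/
noncomputable def adjCount (U : SimpleGraph V) (S : Finset V) : ℕ :=
  ∑ x ∈ S, #{y ∈ S | U.Adj x y}

/-- The number of ordered pairs of adjacent vertices of `U` inside `S` on which `f` agrees. -/
noncomputable def monoCount (U : SimpleGraph V) {ι : Type*} (f : V → ι) (S : Finset V) : ℕ :=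
  ∑ x ∈ S, #{y ∈ S | U.Adj x y ∧ f x = f y}

lemma orderedCliqueCount_two (U : SimpleGraph V) (S : Finset V) :
    U.orderedCliqueCount 2 S = U.adjCount S := by
  simp [orderedCliqueCount, adjCount]

lemma monoCount_le_adjCount (U : SimpleGraph V) {ι : Type*} (f : V → ι) (S : Finset V) :
    U.monoCount f S ≤ U.adjCount S :=
  sum_le_sum fun _ _ => card_le_card fun _ => by simp +contextual

lemma adjCount_le (U : SimpleGraph V) (S : Finset V) : U.adjCount S ≤ #S ^ 2 := by
  rw [sq, adjCount, ← smul_eq_mul]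
  exact sum_le_card_nsmul _ _ _ fun x _ => card_filter_le _ _

/-- Splitting `S` into a neighbourhood and the rest. -/
lemma adjCount_add_adjCount (U : SimpleGraph V) (S A : Finset V) (hA : A ⊆ S) :
    U.adjCount S + U.adjCount (S \ A) =
      U.adjCount A + 2 * ∑ v ∈ S \ A, #{y ∈ S | U.Adj v y} := by
  have h1 : ∀ g : V → ℕ, ∑ x ∈ S, g x = ∑ x ∈ S \ A, g x + ∑ x ∈ A, g x := fun g =>
    (sum_sdiff hA).symm
  simp only [adjCount, card_filter, h1, sum_add_distrib]
  have h2 : ∑ x ∈ A, ∑ y ∈ S \ A, (if U.Adj x y then 1 else 0) =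
      ∑ x ∈ S \ A, ∑ y ∈ A, (if U.Adj x y then 1 else 0) := by
    rw [sum_comm]; simp only [U.adj_comm]
  rw [h2]; ring

/-- Over a random vertex `x`, the degrees outside the neighbourhood of `x` sum up to the product
of the sizes of the two parts on average. -/
lemma sum_sum_degree_compl (U : SimpleGraph V) (S : Finset V) :
    ∑ x ∈ S, ∑ v ∈ S \ {y ∈ S | U.Adj x y}, #{y ∈ S | U.Adj v y} =
      ∑ x ∈ S, #(S \ {y ∈ S | U.Adj x y}) * #{y ∈ S | U.Adj x y} := by
  have h : ∀ x, S \ {y ∈ S | U.Adj x y} = {y ∈ S | ¬ U.Adj x y} := fun x => by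
    ext; simp; tauto
  simp only [h, sum_filter]
  rw [sum_comm]
  refine sum_congr rfl fun v _ => ?_
  simp only [← sum_filter, sum_const, smul_eq_mul, U.adj_comm _ v]

/-- The complement of A becomes a new class of colour 0. In the induction A is the neighbourhood of
a vertex. -/
lemma monoCount_extend (U : SimpleGraph V) {q : ℕ} (f : V → Fin q) (S A : Finset V)
    (hA : A ⊆ S) :
    U.monoCount (fun v => if v ∈ A then (f v).succ else 0) S =
      U.adjCount (S \ A) + U.monoCount f A := by
  have h1 : ∀ g : V → ℕ, ∑ x ∈ S, g x = ∑ x ∈ S \ A, g x + ∑ x ∈ A, g x := fun g =>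
    (sum_sdiff hA).symm
  simp only [adjCount, monoCount, card_filter, h1, sum_add_distrib]
  have e1 : ∑ x ∈ S \ A, ∑ y ∈ A, (if U.Adj x y ∧
      (if x ∈ A then (f x).succ else 0) = (if y ∈ A then (f y).succ else 0) then 1 else 0) = 0 := by
    refine sum_eq_zero fun x hx => sum_eq_zero fun y hy => ?_
    simp [(mem_sdiff.1 hx).2, hy, (Fin.succ_ne_zero _).symm]
  have e2 : ∑ x ∈ A, ∑ y ∈ S \ A, (if U.Adj x y ∧
      (if x ∈ A then (f x).succ else 0) = (if y ∈ A then (f y).succ else 0) then 1 else 0) = 0 := by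
    refine sum_eq_zero fun x hx => sum_eq_zero fun y hy => ?_
    simp [(mem_sdiff.1 hy).2, hx]
  rw [e1, e2, add_zero, zero_add]
  congr 1
  · refine sum_congr rfl fun x hx => sum_congr rfl fun y hy => ?_
    simp [(mem_sdiff.1 hx).2, (mem_sdiff.1 hy).2]
  · refine sum_congr rfl fun x hx => sum_congr rfl fun y hy => ?_
    simp [hx, hy]

/-- A graph with few cliques of order `q + 2` has a partition into `q + 1` classes such that the
number of edges plus the number of edges inside the classes hardly exceeds the Turán bound. -/
theorem exists_partition_adjCount_add_monoCount_le (U : SimpleGraph V) {b : ℝ} (hb : 0 < b)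
    (q : ℕ) (S : Finset V) : ∃ f : V → Fin (q + 1),
      (U.adjCount S : ℝ) + U.monoCount f S ≤
        (1 - 1 / (q + 1 : ℝ)) * (#S : ℝ) ^ 2 + 2 * b ^ 2 +
          2 * U.orderedCliqueCount (q + 2) S / b ^ q := by
  induction q generalizing S with
  | zero =>
    refine ⟨fun _ => 0, ?_⟩
    have h := U.monoCount_le_adjCount (fun _ => (0 : Fin 1)) S
    have h' : (U.monoCount (fun _ => (0 : Fin 1)) S : ℝ) ≤ U.adjCount S := by exact_mod_cast h
    rw [orderedCliqueCount_two]
    simp only [CharP.cast_eq_zero, pow_zero, zero_add, div_one, sub_self, zero_mul]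
    nlinarith [sq_nonneg b]
  | succ q ih =>
    have hq : (0 : ℝ) < q + 1 := by positivity
    -- The parameter b is the size below which S is negligible: there the trivial bound 2|S|²
    -- suffices. Above it, averaging the cliques over S gains a factor 1/|S| < 1/b.
    rcases le_or_gt (#S : ℝ) b with hS | hS
    · refine ⟨fun _ => 0, ?_⟩
      have h := U.monoCount_le_adjCount (fun _ => (0 : Fin (q + 2))) S
      have h' : (U.monoCount (fun _ => (0 : Fin (q + 2))) S : ℝ) ≤ U.adjCount S := by
        exact_mod_cast h
      have h2 : (U.adjCount S : ℝ) ≤ (#S : ℝ) ^ 2 := by exact_mod_cast U.adjCount_le S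
      have h3 : (#S : ℝ) ^ 2 ≤ b ^ 2 := by gcongr
      have h4 : (0 : ℝ) ≤ (1 - 1 / ((q + 1 : ℕ) + 1 : ℝ)) * (#S : ℝ) ^ 2 := by
        refine mul_nonneg ?_ (sq_nonneg _)
        rw [sub_nonneg, div_le_one (by positivity)]
        push_cast; linarith
      have h5 : (0 : ℝ) ≤ 2 * U.orderedCliqueCount (q + 1 + 2) S / b ^ (q + 1) := by positivity
      linarith
    · set Nb : V → Finset V := fun x => {y ∈ S | U.Adj x y} with hNb
      have hNS : ∀ x, Nb x ⊆ S := fun x => filter_subset _ _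
      choose f hf using fun x => ih (Nb x)
      set g : V → V → Fin (q + 2) := fun x v => if v ∈ Nb x then (f x v).succ else 0
      have hS0 : (0 : ℝ) < #S := hb.trans hS
      have hSne : S.Nonempty := by
        rw [← card_pos]; exact_mod_cast hS0
      -- A vertex x is chosen by averaging: its neighbourhood is partitioned by induction and its
      -- non-neighbours form the new class.
      suffices h : ∑ x ∈ S, ((U.adjCount S : ℝ) + U.monoCount (g x) S) ≤
          ∑ x ∈ S, ((1 - 1 / ((q + 1 : ℕ) + 1 : ℝ)) * (#S : ℝ) ^ 2 + 2 * b ^ 2 +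
            2 * U.orderedCliqueCount (q + 1 + 2) S / b ^ (q + 1)) by
        obtain ⟨x, -, hx⟩ := exists_le_of_sum_le hSne h
        exact ⟨g x, hx⟩
      have hdeg : ∑ x ∈ S, ((U.adjCount S : ℝ) + U.adjCount (S \ Nb x)) =
          ∑ x ∈ S, ((U.adjCount (Nb x) : ℝ) + 2 * ((#S : ℝ) - #(Nb x)) * #(Nb x)) := by
        have h1 : ∑ x ∈ S, (U.adjCount S + U.adjCount (S \ Nb x)) =
            ∑ x ∈ S, (U.adjCount (Nb x) + 2 * (#(S \ Nb x) * #(Nb x))) := by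
          rw [sum_congr rfl fun x _ => U.adjCount_add_adjCount S (Nb x) (hNS x),
            sum_add_distrib, sum_add_distrib, ← mul_sum, ← mul_sum, sum_sum_degree_compl]
        have h2 : ∀ x, (#(S \ Nb x) : ℝ) = #S - #(Nb x) := fun x => by
          rw [card_sdiff_of_subset (hNS x), Nat.cast_sub (card_le_card (hNS x))]
        have h3 : ((∑ x ∈ S, (U.adjCount S + U.adjCount (S \ Nb x)) : ℕ) : ℝ) =
            ((∑ x ∈ S, (U.adjCount (Nb x) + 2 * (#(S \ Nb x) * #(Nb x))) : ℕ) : ℝ) := by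
          rw [h1]
        push_cast at h3
        rw [h3]
        refine sum_congr rfl fun x _ => ?_
        rw [h2]; ring
      have hclique : ∑ x ∈ S, (2 * (U.orderedCliqueCount (q + 2) (Nb x) : ℝ) / b ^ q) ≤
          ∑ _x ∈ S, 2 * (U.orderedCliqueCount (q + 1 + 2) S : ℝ) / b ^ (q + 1) := by
        have h1 : (U.orderedCliqueCount (q + 1 + 2) S : ℝ) =
            ∑ x ∈ S, (U.orderedCliqueCount (q + 2) (Nb x) : ℝ) := by
          rw [orderedCliqueCount]; push_cast; rfl
        rw [← sum_div, ← mul_sum, ← h1, sum_const, nsmul_eq_mul, pow_succ, mul_div_assoc',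
          div_le_div_iff₀ (by positivity) (by positivity)]
        have : (0 : ℝ) ≤ 2 * U.orderedCliqueCount (q + 1 + 2) S * b ^ q := by positivity
        nlinarith
      calc ∑ x ∈ S, ((U.adjCount S : ℝ) + U.monoCount (g x) S)
          = ∑ x ∈ S, ((U.adjCount S : ℝ) + U.adjCount (S \ Nb x)) +
              ∑ x ∈ S, (U.monoCount (f x) (Nb x) : ℝ) := by
            rw [← sum_add_distrib]
            refine sum_congr rfl fun x _ => ?_
            rw [U.monoCount_extend (f x) S (Nb x) (hNS x)]
            push_cast; ring
        _ = ∑ x ∈ S, (2 * ((#S : ℝ) - #(Nb x)) * #(Nb x) +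
              ((U.adjCount (Nb x) : ℝ) + U.monoCount (f x) (Nb x))) := by
            rw [hdeg, ← sum_add_distrib]
            exact sum_congr rfl fun x _ => by ring
        _ ≤ ∑ x ∈ S, ((1 - 1 / ((q + 1 : ℕ) + 1 : ℝ)) * (#S : ℝ) ^ 2 + 2 * b ^ 2 +
              2 * (U.orderedCliqueCount (q + 2) (Nb x) : ℝ) / b ^ q) := by
            refine sum_le_sum fun x _ => ?_
            have h1 := hf x
            have h2 : 2 * ((#S : ℝ) - #(Nb x)) * #(Nb x) +
                (1 - 1 / (q + 1 : ℝ)) * (#(Nb x) : ℝ) ^ 2 ≤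
                (1 - 1 / ((q + 1 : ℕ) + 1 : ℝ)) * (#S : ℝ) ^ 2 := by
              set s : ℝ := (#S : ℝ)
              set w : ℝ := (#(Nb x) : ℝ)
              -- Completing the square: equality holds when w/s = (q+1)/(q+2), the degree ratio of
              -- the Turán graph.
              have h3 : (1 - 1 / ((q + 1 : ℕ) + 1 : ℝ)) * s ^ 2 -
                  (2 * (s - w) * w + (1 - 1 / (q + 1 : ℝ)) * w ^ 2) =
                  ((q + 1) * s - (q + 2) * w) ^ 2 / ((q + 1) * (q + 2)) := by
                push_cast
                field_simp
                ring
              have : 0 ≤ ((q + 1) * s - (q + 2) * w) ^ 2 / ((q + 1) * (q + 2)) := by positivity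
              linarith
            linarith
        _ ≤ _ := by
            simp only [sum_add_distrib]
            linarith

end Stability

end SimpleGraph

/-! ### Blow-ups of dense relations -/

section BlowUp

open Finset Function Classical

/-- Resampling the value at `k`. -/
lemma card_mul_card_filter_eq_sum_update {I A : Type*} [Fintype I] [Fintype A] (k : I)
    (B : (I → A) → Prop) [DecidablePred B] :
    Fintype.card A * #{φ : I → A | B φ} = ∑ φ : I → A, #{a : A | B (update φ k a)} := by
  have h1 : Fintype.card A * #{φ : I → A | B φ} = #{z : (I → A) × A | B z.1} := by
    rw [mul_comm, ← card_univ, ← card_product]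
    congr 1; ext; simp
  have h2 : ∑ φ : I → A, #{a : A | B (update φ k a)} =
      #{z : (I → A) × A | B (update z.1 k z.2)} := by
    simp only [card_filter, Fintype.sum_prod_type]
  rw [h1, h2]
  refine card_nbij' (fun z => (update z.1 k (z.2), z.1 k)) (fun z => (update z.1 k (z.2), z.1 k))
    ?_ ?_ ?_ ?_
  · intro z hz; simpa using hz
  · intro z hz; simpa using hz
  · intro z _; simp
  · intro z _; simp

lemma card_filter_apply_mem {T X : Type*} [Fintype T] [Fintype X] (t₀ : T) (S : Finset X)
    [DecidablePred fun a : T → X => a t₀ ∈ S] :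
    Fintype.card X * #{a : T → X | a t₀ ∈ S} = #S * Fintype.card X ^ Fintype.card T := by
  rw [card_mul_card_filter_eq_sum_update t₀ fun a : T → X => a t₀ ∈ S]
  simp [mul_comm]

/-- The systems of `T`-indexed choices in each coordinate all of whose transversals that choose
`t₀` outside `J` satisfy `R`. -/
noncomputable def blowUpSet {I T V : Type*} [Fintype I] [Fintype T] [Fintype V]
    (R : (I → V) → Prop) (t₀ : T) (J : Finset I) : Finset (I → T → V) :=
  {φ | ∀ s : I → T, (∀ i ∉ J, s i = t₀) → R fun i => φ i (s i)}

/-- With the other coordinates fixed, membership for J asks one value in coordinate k to lie in a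
set `S φ`, and membership for `insert k J` asks all |T| values to lie in it. The two densities are
the means of |S φ|/n and of its |T|-th power, which Jensen's inequality compares. -/
lemma density_blowUpSet_insert {I T V : Type*} [Fintype I] [Fintype T] [Fintype V] [Nonempty V]
    (R : (I → V) → Prop) (t₀ : T) (J : Finset I) (k : I) (hk : k ∉ J) :
    ((#(blowUpSet R t₀ J) : ℝ) / Fintype.card (I → T → V)) ^ Fintype.card T ≤
      (#(blowUpSet R t₀ (insert k J)) : ℝ) / Fintype.card (I → T → V) := by
  set n : ℝ := (Fintype.card V : ℝ) with hn
  have hn0 : 0 < n := by rw [hn]; exact_mod_cast Fintype.card_pos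
  set M : ℝ := (Fintype.card (I → T → V) : ℝ) with hM
  have hM0 : 0 < M := by rw [hM]; exact_mod_cast Fintype.card_pos
  let S : (I → T → V) → Finset V := fun φ =>
    {x | ∀ s : I → T, (∀ i ∉ insert k J, s i = t₀) → R (update (fun i => φ i (s i)) k x)}
  have key : ∀ (φ : I → T → V) (a : T → V) (s : I → T),
      (fun i => update φ k a i (s i)) = update (fun i => φ i (s i)) k (a (s k)) := by
    intro φ a s
    ext i
    by_cases hi : i = k
    · subst hi; simp
    · simp [hi]
  have hJ : ∀ (φ : I → T → V) (a : T → V),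
      update φ k a ∈ blowUpSet R t₀ J ↔ a t₀ ∈ S φ := by
    intro φ a
    simp only [blowUpSet, mem_filter, mem_univ, true_and, S, key]
    constructor
    · intro h s hs
      have := h (update s k t₀) fun i hi => by
        by_cases hik : i = k
        · simp [hik]
        · simp only [update_of_ne hik]; exact hs i (by simp [hik, hi])
      convert this using 1
      ext i
      by_cases hik : i = k
      · subst hik; simp
      · simp [hik]
    · intro h s hs
      rw [hs k hk]
      exact h s fun i hi => hs i fun h' => hi (mem_insert_of_mem h')
  have hJ' : ∀ (φ : I → T → V) (a : T → V),
      update φ k a ∈ blowUpSet R t₀ (insert k J) ↔ ∀ τ, a τ ∈ S φ := by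
    intro φ a
    simp only [blowUpSet, mem_filter, mem_univ, true_and, S, key]
    constructor
    · intro h τ s hs
      have := h (update s k τ) fun i hi => by
        have hik : i ≠ k := fun h' => hi (by simp [h'])
        rw [update_of_ne hik]; exact hs i hi
      convert this using 1
      ext i
      by_cases hik : i = k
      · subst hik; simp
      · simp [hik]
    · exact fun h s hs => h _ s hs
  have e1 : (#(blowUpSet R t₀ J) : ℝ) = ∑ φ, (#(S φ) : ℝ) / n := by
    have h := card_mul_card_filter_eq_sum_update k (fun φ => φ ∈ blowUpSet R t₀ J)
    simp only [hJ, filter_univ_mem] at h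
    have h2 : ∀ φ, (#{a : T → V | a t₀ ∈ S φ} : ℝ) = #(S φ) / n * n ^ Fintype.card T := by
      intro φ
      have h3 : n * #{a : T → V | a t₀ ∈ S φ} = #(S φ) * n ^ Fintype.card T := by
        rw [hn]; exact_mod_cast card_filter_apply_mem t₀ (S φ)
      field_simp
      linarith
    have h4 : n ^ Fintype.card T * (#(blowUpSet R t₀ J) : ℝ) =
        ∑ φ, (#{a : T → V | a t₀ ∈ S φ} : ℝ) := by
      have := congrArg (Nat.cast : ℕ → ℝ) h
      simpa using this
    rw [sum_congr rfl fun φ _ => h2 φ, ← sum_mul, mul_comm] at h4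
    exact mul_right_cancel₀ (by positivity) h4
  have e2 : (#(blowUpSet R t₀ (insert k J)) : ℝ) = ∑ φ, ((#(S φ) : ℝ) / n) ^ Fintype.card T := by
    have h := card_mul_card_filter_eq_sum_update k (fun φ => φ ∈ blowUpSet R t₀ (insert k J))
    simp only [hJ', filter_univ_mem] at h
    have h2 : ∀ φ, #{a : T → V | ∀ τ, a τ ∈ S φ} = #(S φ) ^ Fintype.card T := by
      intro φ
      have : ({a : T → V | ∀ τ, a τ ∈ S φ} : Finset (T → V)) = Fintype.piFinset fun _ => S φ := by
        ext; simp
      rw [this]; simp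
    have h4 : n ^ Fintype.card T * (#(blowUpSet R t₀ (insert k J)) : ℝ) =
        ∑ φ, (#(S φ) : ℝ) ^ Fintype.card T := by
      have := congrArg (Nat.cast : ℕ → ℝ) h
      simpa [h2] using this
    simp only [div_pow, ← sum_div]
    rw [← h4]; field_simp
  obtain ⟨t, ht⟩ : ∃ t, Fintype.card T = t + 1 :=
    Nat.exists_eq_succ_of_ne_zero (Fintype.card_pos_iff.2 ⟨t₀⟩).ne'
  have hpm := pow_sum_div_card_le_sum_pow (s := (univ : Finset (I → T → V)))
    (f := fun φ => (#(S φ) : ℝ) / n) (fun φ _ => by positivity) t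
  rw [e1, e2, ht, div_pow, pow_succ M, ← div_div]
  gcongr
  simpa [hM] using hpm

lemma card_blowUpSet_empty {I T V : Type*} [Fintype I] [Fintype T] [Fintype V] [Nonempty V]
    (R : (I → V) → Prop) (t₀ : T) :
    (#(blowUpSet R t₀ ∅) : ℝ) / Fintype.card (I → T → V) =
      (#{ψ | R ψ} : ℝ) / Fintype.card (I → V) := by
  have h := card_filter_apply_mem t₀ ({ψ | R ψ} : Finset (I → V))
  have h1 : #{a : T → I → V | a t₀ ∈ ({ψ | R ψ} : Finset (I → V))} = #(blowUpSet R t₀ ∅) := by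
    refine card_nbij' (fun a i t => a t i) (fun a t i => a i t) ?_ ?_ ?_ ?_
    · intro a ha
      simp only [blowUpSet, coe_filter, mem_univ, true_and, Set.mem_ofPred_eq, mem_filter] at ha ⊢
      intro s hs
      simpa [hs] using ha
    · intro a ha
      simp only [blowUpSet, coe_filter, mem_univ, true_and, Set.mem_ofPred_eq, mem_filter] at ha ⊢
      exact ha (fun _ => t₀) fun _ _ => rfl
    · intro a _; rfl
    · intro a _; rfl
  rw [h1] at h
  have h2 : Fintype.card (I → T → V) = Fintype.card (I → V) ^ Fintype.card T := by
    simp only [Fintype.card_fun, ← pow_mul, mul_comm]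
  have h3 : (0 : ℝ) < Fintype.card (I → V) := by exact_mod_cast Fintype.card_pos
  rw [h2, div_eq_div_iff (by positivity) (by positivity)]
  rw [mul_comm]
  exact_mod_cast h

/-- A relation of density `η` has a `T`-fold blow-up of density at least `η ^ |T| ^ |I|`. -/
theorem pow_density_le_density_blowUpSet {I T V : Type*} [Fintype I] [Fintype T] [Fintype V]
    [Nonempty V] (R : (I → V) → Prop) (t₀ : T) :
    ((#{ψ | R ψ} : ℝ) / Fintype.card (I → V)) ^ (Fintype.card T ^ Fintype.card I) ≤
      (#(blowUpSet R t₀ univ) : ℝ) / Fintype.card (I → T → V) := by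
  suffices h : ∀ J : Finset I,
      ((#{ψ | R ψ} : ℝ) / Fintype.card (I → V)) ^ (Fintype.card T ^ #J) ≤
        (#(blowUpSet R t₀ J) : ℝ) / Fintype.card (I → T → V) from h univ
  intro J
  induction J using Finset.induction_on with
  | empty => rw [card_empty, pow_zero, pow_one, card_blowUpSet_empty]
  | insert k J hk ih =>
    refine le_trans ?_ (density_blowUpSet_insert R t₀ J k hk)
    rw [card_insert_of_notMem hk, pow_succ, pow_mul]
    gcongr

lemma card_filter_apply_mem_le {I V : Type*} [Fintype I] [Fintype V] (S : V → V → Finset V)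
    {s : ℕ} (hS : ∀ a b, #(S a b) ≤ s) (k p q : I) (hp : k ≠ p) (hq : k ≠ q)
    [DecidablePred fun φ : I → V => φ k ∈ S (φ p) (φ q)] :
    Fintype.card V * #{φ : I → V | φ k ∈ S (φ p) (φ q)} ≤ s * Fintype.card (I → V) := by
  rw [card_mul_card_filter_eq_sum_update k fun φ : I → V => φ k ∈ S (φ p) (φ q), mul_comm, ← smul_eq_mul, ← card_univ]
  refine sum_le_card_nsmul _ _ _ fun φ _ => ?_
  simpa [update_of_ne hp.symm, update_of_ne hq.symm] using hS _ _

/-- A relation of positive density on a large set has a blow-up avoiding a sparse relation. -/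
theorem exists_mem_blowUpSet_forall_notMem {I T V : Type*} [Fintype I] [Fintype T] [Fintype V]
    (R : (I → V) → Prop) (t₀ : T) (S : V → V → Finset V) {s : ℕ} (hS : ∀ a b, #(S a b) ≤ s)
    {η : ℝ} (hη : 0 ≤ η) (hR : η * Fintype.card (I → V) ≤ #{ψ | R ψ})
    (hV : (Fintype.card (I × T) : ℝ) ^ 3 * s <
      Fintype.card V * η ^ (Fintype.card T ^ Fintype.card I)) :
    ∃ φ : I → T → V, (∀ s : I → T, R fun i => φ i (s i)) ∧
      ∀ k p q : I × T, k ≠ p → k ≠ q → φ k.1 k.2 ∉ S (φ p.1 p.2) (φ q.1 q.2) := by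
  have hn0 : (0 : ℝ) < Fintype.card V := by
    by_contra h
    have : (Fintype.card V : ℝ) = 0 := le_antisymm (not_lt.1 h) (by positivity)
    rw [this, zero_mul] at hV
    exact absurd hV (not_lt.2 (by positivity))
  have : Nonempty V := Fintype.card_pos_iff.1 (by exact_mod_cast hn0)
  have hM0 : (0 : ℝ) < Fintype.card (I → T → V) := by exact_mod_cast Fintype.card_pos
  by_contra! hcon
  -- A union bound over triples. The case p = q is kept, as it later yields injectivity.
  let K : Finset ((I × T) × (I × T) × (I × T)) := {z | z.1 ≠ z.2.1 ∧ z.1 ≠ z.2.2}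
  let B : (I × T) × (I × T) × (I × T) → Finset (I → T → V) := fun z =>
    {φ | φ z.1.1 z.1.2 ∈ S (φ z.2.1.1 z.2.1.2) (φ z.2.2.1 z.2.2.2)}
  have hsub : blowUpSet R t₀ univ ⊆ K.biUnion B := by
    intro φ hφ
    obtain ⟨k, p, q, h1, h2, h3⟩ := hcon φ fun s =>
      (mem_filter.1 hφ).2 s fun i hi => absurd (mem_univ i) hi
    exact mem_biUnion.2 ⟨(k, p, q), by simp [K, h1, h2], by simpa [B] using h3⟩
  have hB : ∀ z ∈ K, Fintype.card V * #(B z) ≤ s * Fintype.card (I → T → V) := by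
    intro z hz
    obtain ⟨h1, h2⟩ := (mem_filter.1 hz).2
    have h : Fintype.card V * #{φ : I × T → V | φ z.1 ∈ S (φ z.2.1) (φ z.2.2)} ≤
        s * Fintype.card (I × T → V) := by
      convert card_filter_apply_mem_le S hS z.1 z.2.1 z.2.2 h1 h2
    have h3 : #{φ : I × T → V | φ z.1 ∈ S (φ z.2.1) (φ z.2.2)} = #(B z) :=
      card_equiv (Equiv.curry I T V) fun φ => by simp [B]
    rw [h3] at h
    rwa [Fintype.card_congr (Equiv.curry I T V)] at h
  have hK : #K ≤ Fintype.card (I × T) ^ 3 := by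
    refine (card_le_univ _).trans (le_of_eq ?_)
    rw [Fintype.card_prod, Fintype.card_prod (I × T) (I × T)]; ring
  have hcount : Fintype.card V * #(blowUpSet R t₀ univ) ≤
      Fintype.card (I × T) ^ 3 * (s * Fintype.card (I → T → V)) :=
    calc Fintype.card V * #(blowUpSet R t₀ univ)
        ≤ Fintype.card V * ∑ z ∈ K, #(B z) := by
          gcongr; exact (card_le_card hsub).trans card_biUnion_le
      _ = ∑ z ∈ K, Fintype.card V * #(B z) := mul_sum _ _ _
      _ ≤ #K • (s * Fintype.card (I → T → V)) := sum_le_card_nsmul _ _ _ hB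
      _ ≤ _ := by rw [smul_eq_mul]; gcongr
  have hcount' : (Fintype.card V : ℝ) * #(blowUpSet R t₀ univ) ≤
      (Fintype.card (I × T) : ℝ) ^ 3 * (s * Fintype.card (I → T → V)) := by
    exact_mod_cast hcount
  have h1 : η ^ (Fintype.card T ^ Fintype.card I) ≤
      (#(blowUpSet R t₀ univ) : ℝ) / Fintype.card (I → T → V) := by
    refine le_trans ?_ (pow_density_le_density_blowUpSet R t₀)
    gcongr
    rw [le_div_iff₀ (by exact_mod_cast Fintype.card_pos)]
    exact hR
  rw [le_div_iff₀ hM0] at h1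
  have h2 : (Fintype.card V : ℝ) * (η ^ (Fintype.card T ^ Fintype.card I) *
      Fintype.card (I → T → V)) ≤ Fintype.card V * #(blowUpSet R t₀ univ) := by gcongr
  have h3 := mul_lt_mul_of_pos_right hV hM0
  linarith

end BlowUp

namespace SimpleGraph

/-! ### Upper bound for packings without rainbow copies -/

section UpperBound

open Finset Function Classical

lemma orderedCliqueCount_eq_card {V : Type*} [Fintype V] (U : SimpleGraph V) (j : ℕ)
    (S : Finset V) : U.orderedCliqueCount j S =
      #{ψ : Fin j → V | (∀ i, ψ i ∈ S) ∧ ∀ i i', i ≠ i' → U.Adj (ψ i) (ψ i')} := by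
  induction j generalizing S with
  | zero => simp [orderedCliqueCount]
  | succ j ih =>
    simp only [orderedCliqueCount, ih]
    rw [← card_sigma]
    refine card_bij' (fun z _ => Fin.cons z.1 z.2) (fun ψ _ => ⟨ψ 0, Fin.tail ψ⟩) ?_ ?_ ?_ ?_
    · rintro ⟨x, ψ⟩ h
      simp only [mem_sigma, mem_filter, mem_univ, true_and] at h ⊢
      obtain ⟨hx, hS, hadj⟩ := h
      refine ⟨fun i => ?_, fun i i' => ?_⟩
      · refine Fin.cases ?_ (fun i => ?_) i
        · simpa using hx
        · simpa using (hS i).1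
      · refine Fin.cases ?_ (fun i => ?_) i <;> refine Fin.cases ?_ (fun i' => ?_) i'
        · simp
        · intro _; simpa using (hS i').2
        · intro _; simpa using (hS i).2.symm
        · intro h; simpa using hadj i i' fun h' => h (by rw [h'])
    · intro ψ h
      simp only [mem_sigma, mem_filter, mem_univ, true_and] at h ⊢
      refine ⟨h.1 0, fun i => ⟨h.1 i.succ, h.2 _ _ (Fin.succ_ne_zero i).symm⟩, fun i i' hi => ?_⟩
      exact h.2 _ _ fun h' => hi (Fin.succ_injective _ h')
    · rintro ⟨x, ψ⟩ h; simp
    · intro ψ h; simp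

lemma card_adj_pairs {V : Type*} [Fintype V] (F : SimpleGraph V) :
    #{z : V × V | F.Adj z.1 z.2} = 2 * F.edgeSet.ncard := by
  rw [Set.ncard_eq_toFinset_card', ← edgeFinset, ← sum_degrees_eq_twice_card_edges, card_filter,
    Fintype.sum_prod_type]
  refine sum_congr rfl fun x _ => ?_
  rw [← card_filter, ← card_neighborFinset_eq_degree, neighborFinset_eq_filter]

variable {V : Type*} {n : ℕ}

/-- The union of a family of subgraphs. -/
def familyUnion (P : Finset (⊤ : SimpleGraph (Fin n)).Subgraph) : SimpleGraph (Fin n) where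
  Adj a b := ∃ A ∈ P, A.Adj a b
  symm := ⟨fun _ _ ⟨A, hA, h⟩ => ⟨A, hA, h.symm⟩⟩
  loopless := ⟨fun _ ⟨_, _, h⟩ => h.ne rfl⟩

lemma IsEdgeDisjointCopies.eq_of_adj {F : SimpleGraph V}
    {P : Finset (⊤ : SimpleGraph (Fin n)).Subgraph} (hP : F.IsEdgeDisjointCopies P)
    {A B : (⊤ : SimpleGraph (Fin n)).Subgraph} (hA : A ∈ P) (hB : B ∈ P) {a b : Fin n}
    (h1 : A.Adj a b) (h2 : B.Adj a b) : A = B := by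
  by_contra h
  exact Set.disjoint_left.1 (hP.2 A hA B hB h) (Subgraph.mem_edgeSet.2 h1)
    (Subgraph.mem_edgeSet.2 h2)

/-- Edge-disjointness makes counts of adjacent pairs additive over the packing. -/
lemma IsEdgeDisjointCopies.card_filter_adj {F : SimpleGraph V}
    {P : Finset (⊤ : SimpleGraph (Fin n)).Subgraph} (hP : F.IsEdgeDisjointCopies P)
    (Q : Fin n × Fin n → Prop) :
    #{z : Fin n × Fin n | (familyUnion P).Adj z.1 z.2 ∧ Q z} =
      ∑ A ∈ P, #{z : Fin n × Fin n | A.Adj z.1 z.2 ∧ Q z} := by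
  rw [← card_biUnion]
  · congr 1
    ext z
    simp only [mem_filter, mem_univ, true_and, mem_biUnion]
    constructor
    · rintro ⟨⟨A, hA, h⟩, hQ⟩
      exact ⟨A, hA, h, hQ⟩
    · rintro ⟨A, hA, h, hQ⟩
      exact ⟨⟨A, hA, h⟩, hQ⟩
  · intro A hA B hB hAB
    refine Finset.disjoint_left.2 fun z h1 h2 => ?_
    simp only [mem_filter, mem_univ, true_and] at h1 h2
    exact hAB (hP.eq_of_adj hA hB h1.1 h2.1)

lemma card_adj_pairs_of_iso [Fintype V] {F : SimpleGraph V}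
    {A : (⊤ : SimpleGraph (Fin n)).Subgraph} (e : F ≃g A.coe) :
    #{z : Fin n × Fin n | A.Adj z.1 z.2} = 2 * F.edgeSet.ncard := by
  rw [← card_adj_pairs]
  symm
  refine card_bij (fun z _ => ((e z.1 : Fin n), (e z.2 : Fin n))) ?_ ?_ ?_
  · intro z hz
    simp only [mem_filter, mem_univ, true_and] at hz ⊢
    exact e.map_rel_iff.2 hz
  · rintro ⟨a, b⟩ _ ⟨a', b'⟩ _ h
    simpa [Subtype.val_inj] using h
  · rintro ⟨a, b⟩ h
    simp only [mem_filter, mem_univ, true_and] at h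
    refine ⟨(e.symm ⟨a, h.fst_mem⟩, e.symm ⟨b, h.snd_mem⟩), ?_, by simp⟩
    simp only [mem_filter, mem_univ, true_and]
    rw [← e.map_rel_iff]
    simpa using h

lemma adjCount_univ_eq_card {X : Type*} [Fintype X] (U : SimpleGraph X) :
    U.adjCount univ = #{z : X × X | U.Adj z.1 z.2} := by
  simp only [adjCount, card_filter, Fintype.sum_prod_type]

lemma monoCount_univ_eq_card {X ι : Type*} [Fintype X] (U : SimpleGraph X) (f : X → ι) :
    U.monoCount f univ = #{z : X × X | U.Adj z.1 z.2 ∧ f z.1 = f z.2} := by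
  simp only [monoCount, card_filter, Fintype.sum_prod_type]

lemma IsEdgeDisjointCopies.adjCount_eq [Fintype V] {F : SimpleGraph V}
    {P : Finset (⊤ : SimpleGraph (Fin n)).Subgraph} (hP : F.IsEdgeDisjointCopies P) :
    (familyUnion P).adjCount univ = #P * (2 * F.edgeSet.ncard) := by
  have h := hP.card_filter_adj fun _ => True
  simp only [and_true] at h
  rw [adjCount_univ_eq_card, h, ← smul_eq_mul, ← sum_const]
  refine sum_congr rfl fun A hA => ?_
  obtain ⟨e⟩ := hP.1 A hA
  exact card_adj_pairs_of_iso e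

/-- A partition into too few classes to colour `F` has an edge of each copy inside a class. -/
lemma IsEdgeDisjointCopies.two_mul_card_le_monoCount {F : SimpleGraph V}
    {P : Finset (⊤ : SimpleGraph (Fin n)).Subgraph} (hP : F.IsEdgeDisjointCopies P) {p : ℕ}
    (hF : ¬ F.Colorable p) (f : Fin n → Fin p) : #P * 2 ≤ (familyUnion P).monoCount f univ := by
  rw [monoCount_univ_eq_card, hP.card_filter_adj fun z => f z.1 = f z.2, ← smul_eq_mul]
  refine card_nsmul_le_sum _ _ _ fun A hA => ?_
  obtain ⟨e⟩ := hP.1 A hA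
  obtain ⟨a, b, hab, hf⟩ : ∃ a b, A.Adj a b ∧ f a = f b := by
    by_contra! h
    exact hF ⟨Coloring.mk (fun v => f (e v)) fun {v w} hvw => h _ _ (e.map_rel_iff.2 hvw)⟩
  -- Both orientations of the inner edge count, hence the factor 2.
  have hne : ((a, b) : Fin n × Fin n) ≠ (b, a) := fun h => hab.ne (Prod.mk.inj h).1
  rw [← card_pair hne]
  refine card_le_card fun z hz => ?_
  simp only [mem_insert, mem_singleton] at hz
  rcases hz with rfl | rfl
  · simp [hab, hf]
  · simp [hab.symm, hf]

/-- A packing without rainbow copy of an `r`-colourable graph has a union with few cliques of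
order `r`. -/
theorem IsEdgeDisjointCopies.orderedCliqueCount_lt {W : Type*} [Fintype V] [Fintype W]
    [Nonempty W] {F : SimpleGraph V} {G : SimpleGraph W}
    {P : Finset (⊤ : SimpleGraph (Fin n)).Subgraph} (hP : F.IsEdgeDisjointCopies P)
    (hG : ¬ G.HasRainbowCopy P) {r : ℕ} (c : G.Coloring (Fin r)) {η : ℝ} (hη : 0 ≤ η)
    (hn : ((r * Fintype.card W : ℕ) : ℝ) ^ 3 * ((Fintype.card V + 1 : ℕ) : ℝ) <
      n * η ^ (Fintype.card W ^ r)) :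
    ((familyUnion P).orderedCliqueCount r univ : ℝ) < η * (n : ℝ) ^ r := by
  by_contra! hcon
  apply hG
  -- Avoiding `a` will make the embedding injective; avoiding the vertices of the copy through ab,
  -- unique if it exists, will make it rainbow.
  let S : Fin n → Fin n → Finset (Fin n) := fun a b =>
    insert a (univ.filter fun x => ∃ A ∈ P, A.Adj a b ∧ x ∈ A.verts)
  have hS : ∀ a b, #(S a b) ≤ Fintype.card V + 1 := by
    intro a b
    refine (card_insert_le _ _).trans (Nat.succ_le_succ ?_)
    by_cases h : ∃ A ∈ P, A.Adj a b
    · obtain ⟨A, hA, hab⟩ := h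
      obtain ⟨e⟩ := hP.1 A hA
      rw [← card_univ]
      refine card_le_card_of_surjOn (fun v => (e v : Fin n)) fun x hx => ?_
      simp only [coe_filter, mem_univ, true_and, Set.mem_ofPred_eq] at hx
      obtain ⟨B, hB, hB', hx⟩ := hx
      obtain rfl := hP.eq_of_adj hA hB hab hB'
      exact ⟨e.symm ⟨x, hx⟩, by simp, by simp⟩
    · rw [filter_eq_empty_iff.2 fun x _ ⟨A, hA, hab, _⟩ => h ⟨A, hA, hab⟩]
      simp
  let t₀ : W := Classical.arbitrary W
  -- Each colour class of the blow-up has one slot per vertex of G; the vertex w takes its own slot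
  -- in class `c w`.
  obtain ⟨φ, hφ, hφS⟩ := exists_mem_blowUpSet_forall_notMem (I := Fin r)
    (fun ψ : Fin r → Fin n => ∀ i i', i ≠ i' → (familyUnion P).Adj (ψ i) (ψ i')) t₀ S hS hη
    (by
      rw [orderedCliqueCount_eq_card] at hcon
      simp only [mem_univ, implies_true, true_and] at hcon
      have hcard : (Fintype.card (Fin r → Fin n) : ℝ) = (n : ℝ) ^ r := by simp
      rw [← hcard] at hcon
      exact (le_of_eq (by congr!)).trans (hcon.trans_eq (by congr!)))
    (by simpa using hn)
  have hadj : ∀ u v, G.Adj u v → (familyUnion P).Adj (φ (c u) u) (φ (c v) v) := by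
    intro u v huv
    have hc := c.valid huv
    -- This transversal takes slot u in class `c u` and slot v in every other class.
    have := hφ (update (fun _ => v) (c u) u) (c u) (c v) hc
    simpa [update_of_ne hc.symm] using this
  have hinj : Injective fun w => φ (c w) w := by
    intro w w' h
    by_contra hne
    refine hφS (c w, w) (c w', w') (c w', w') (fun h' => hne (Prod.mk.inj h').2)
      (fun h' => hne (Prod.mk.inj h').2) ?_
    simpa [S] using Or.inl h
  have hcol : ∀ e : G.edgeSet, ∃ A ∈ P,
      Sym2.map (fun w => φ (c w) w) (e : Sym2 W) ∈ A.edgeSet := by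
    rintro ⟨e, he⟩
    induction e using Sym2.ind with
    | _ u v =>
      obtain ⟨A, hA, h⟩ := hadj u v he
      exact ⟨A, hA, by simpa using h⟩
  choose C hCP hC using hcol
  refine ⟨⟨fun w => φ (c w) w, hinj⟩, C, ?_, fun e => ⟨hCP e, hC e⟩⟩
  rintro ⟨e, he⟩ ⟨e', he'⟩ hee
  have h1 := hC ⟨e, he⟩
  have h2 := hC ⟨e', he'⟩
  rw [← hee] at h2
  have hA := hCP ⟨e, he⟩
  generalize C ⟨e, he⟩ = A at h1 h2 hA
  clear hee
  induction e using Sym2.ind with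
  | _ u v =>
    induction e' using Sym2.ind with
    | _ u' v' =>
      simp only [Sym2.map_mk, Subgraph.mem_edgeSet] at h1 h2
      -- The copy through the image of uv meets the image of G only in the images of u and v, so no
      -- second edge can have its colour.
      have key : ∀ w, φ (c w) w ∈ A.verts → w = u ∨ w = v := by
        intro w hw
        by_contra! hne
        refine hφS (c w, w) (c u, u) (c v, v) (fun h' => hne.1 (Prod.mk.inj h').2)
          (fun h' => hne.2 (Prod.mk.inj h').2) ?_
        simp only [S, mem_insert, mem_filter, mem_univ, true_and]
        exact Or.inr ⟨A, hA, h1, hw⟩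
      have hne : u' ≠ v' := G.ne_of_adj he'
      refine Subtype.ext (Sym2.eq_iff.2 ?_)
      rcases key u' h2.fst_mem with rfl | rfl <;> rcases key v' h2.snd_mem with rfl | rfl <;>
        simp_all

/-- The size of a packing without rainbow copy of a `(q + 2)`-colourable graph, with an improved
bound if the packed graph is not `(q + 1)`-colourable. -/
theorem eventually_card_packing_le {W : Type*} [Finite V] [Finite W] [Nonempty W]
    (F : SimpleGraph V) (G : SimpleGraph W) {q : ℕ} (hG : G.Colorable (q + 2)) {ε : ℝ}
    (hε : 0 < ε) : ∀ᶠ n : ℕ in atTop, ∀ P : Finset (⊤ : SimpleGraph (Fin n)).Subgraph,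
      F.IsEdgeDisjointCopies P → ¬ G.HasRainbowCopy P →
        2 * (F.edgeSet.ncard : ℝ) * #P ≤ (1 - 1 / (q + 1 : ℝ) + ε) * (n : ℝ) ^ 2 ∧
        (¬ F.Colorable (q + 1) → 2 * ((F.edgeSet.ncard : ℝ) + 1) * #P ≤
          (1 - 1 / (q + 1 : ℝ) + ε) * (n : ℝ) ^ 2) := by
  have := Fintype.ofFinite V
  have := Fintype.ofFinite W
  obtain ⟨c⟩ := hG
  -- With b = αn the term 2b² equals (ε/2)n², and η is chosen so that the clique term is also at
  -- most (ε/2)n².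
  set α : ℝ := √ε / 2 with hα
  have hα0 : 0 < α := by positivity
  have hα2 : α ^ 2 = ε / 4 := by rw [hα, div_pow, Real.sq_sqrt hε.le]; norm_num
  set η : ℝ := α ^ q * ε / 4 with hη
  have hη0 : 0 < η := by positivity
  have hlim : Tendsto (fun n : ℕ => (n : ℝ) * η ^ (Fintype.card W ^ (q + 2))) atTop atTop :=
    tendsto_natCast_atTop_atTop.atTop_mul_const (by positivity)
  filter_upwards [hlim.eventually_gt_atTop
    ((((q + 2) * Fintype.card W : ℕ) : ℝ) ^ 3 * ((Fintype.card V + 1 : ℕ) : ℝ)),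
    eventually_gt_atTop 0] with n hn hn0 P hP hGP
  have hn0' : (0 : ℝ) < n := by exact_mod_cast hn0
  have hK := hP.orderedCliqueCount_lt hGP c hη0.le hn
  obtain ⟨f, hf⟩ := exists_partition_adjCount_add_monoCount_le (familyUnion P)
    (mul_pos hα0 hn0') q univ
  rw [hP.adjCount_eq] at hf
  have hKb : 2 * ((familyUnion P).orderedCliqueCount (q + 2) univ : ℝ) / (α * n) ^ q ≤
      ε / 2 * (n : ℝ) ^ 2 := by
    rw [div_le_iff₀ (by positivity)]
    calc 2 * ((familyUnion P).orderedCliqueCount (q + 2) univ : ℝ)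
        ≤ 2 * (η * (n : ℝ) ^ (q + 2)) := by gcongr
      _ = ε / 2 * (n : ℝ) ^ 2 * (α * n) ^ q := by rw [hη, mul_pow]; ring
  have hbound : (#P : ℝ) * (2 * F.edgeSet.ncard) + (familyUnion P).monoCount f univ ≤
      (1 - 1 / (q + 1 : ℝ) + ε) * (n : ℝ) ^ 2 := by
    push_cast at hf
    simp only [card_univ, Fintype.card_fin, mul_pow, hα2] at hf
    rw [mul_pow] at hKb
    linarith
  refine ⟨?_, fun hF => ?_⟩
  · have : (0 : ℝ) ≤ (familyUnion P).monoCount f univ := by positivity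
    linarith
  · have : (#P : ℝ) * 2 ≤ (familyUnion P).monoCount f univ := by
      exact_mod_cast hP.two_mul_card_le_monoCount hF f
    linarith

end UpperBound

end SimpleGraph

/-! ### Classes of power residues in finite fields -/

section PowerResidues

open Finset Polynomial

variable {K : Type*} [Field K] [Fintype K] [DecidableEq K] {M N : ℕ}

lemma card_nthRootsFinset_of_mul_eq (hMN : M * N = Fintype.card K - 1) :
    #(nthRootsFinset N (1 : K)) = N := by
  obtain ⟨g, hg⟩ := IsCyclic.exists_generator (α := Kˣ)
  have ho : orderOf g = M * N := by
    rw [orderOf_eq_card_of_forall_mem_zpowers hg, Nat.card_eq_fintype_card, Fintype.card_units, hMN]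
  have hpos : 0 < M * N := ho ▸ orderOf_pos g
  have h : IsPrimitiveRoot (g ^ M) N := by
    have h1 := IsPrimitiveRoot.orderOf g
    rw [ho] at h1
    exact h1.pow hpos rfl
  have h' : IsPrimitiveRoot ((g ^ M : Kˣ) : K) N := IsPrimitiveRoot.coe_units_iff.2 h
  exact h'.card_nthRootsFinset

-- The class of a nonzero z is recorded by z^M, an N-th root of unity; the classes are the cosets of
-- the group of M-th roots of unity.
omit [DecidableEq K] in
lemma pow_mem_nthRootsFinset (hN : 0 < N) (hMN : M * N = Fintype.card K - 1) {z : K} (hz : z ≠ 0) :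
    z ^ M ∈ nthRootsFinset N (1 : K) := by
  rw [mem_nthRootsFinset hN, ← pow_mul, hMN, FiniteField.pow_card_sub_one_eq_one z hz]

/-- The classes of power residues are equidistributed on translates of a set in mean square. -/
lemma sum_sum_sq_card_filter_sub_le (hM : 0 < M) (hN : 0 < N) (hMN : M * N = Fintype.card K - 1)
    (C : Finset K) :
    ∑ x : K, ∑ t ∈ nthRootsFinset N (1 : K),
      ((#{y ∈ C | (x - y) ^ M = t} : ℝ) - #C / N) ^ 2 ≤ 3 * #C * Fintype.card K := by
  set Λ := nthRootsFinset N (1 : K)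
  set Q : ℝ := (Fintype.card K : ℝ) with hQ
  have hN' : (0 : ℝ) < N := by exact_mod_cast hN
  have hQ1 : (M : ℝ) * N = Q - 1 := by
    have := congrArg (Nat.cast : ℕ → ℝ) hMN
    rw [Nat.cast_sub Fintype.card_pos] at this
    push_cast at this; exact this
  have hΛ : (#Λ : ℝ) = N := by rw [card_nthRootsFinset_of_mul_eq hMN]
  have hCQ : (#C : ℝ) ≤ Q := by rw [hQ]; exact_mod_cast card_le_univ C
  have h0 : (0 : K) ∉ Λ := by
    rw [mem_nthRootsFinset hN, zero_pow hN.ne']; exact zero_ne_one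
  have hsq : ∑ x : K, ∑ t ∈ Λ, (#{y ∈ C | (x - y) ^ M = t} : ℝ) ^ 2 ≤ #C * Q + #C ^ 2 * M := by
    have h1 : ∑ x : K, ∑ t ∈ Λ, #{y ∈ C | (x - y) ^ M = t} ^ 2 ≤
        ∑ z ∈ C ×ˢ C, #{x : K | x ≠ z.1 ∧ x ≠ z.2 ∧ (x - z.1) ^ M = (x - z.2) ^ M} := by
      have hcomm : ∑ z ∈ C ×ˢ C, #{x : K | x ≠ z.1 ∧ x ≠ z.2 ∧ (x - z.1) ^ M = (x - z.2) ^ M} =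
          ∑ x : K, #{z ∈ C ×ˢ C | x ≠ z.1 ∧ x ≠ z.2 ∧ (x - z.1) ^ M = (x - z.2) ^ M} := by
        simp only [card_filter]
        exact sum_comm
      rw [hcomm]
      refine sum_le_sum fun x _ => ?_
      have h2 : ∀ t, #{y ∈ C | (x - y) ^ M = t} ^ 2 =
          #{z ∈ C ×ˢ C | (x - z.1) ^ M = t ∧ (x - z.2) ^ M = t} := by
        intro t
        rw [sq, ← card_product]
        congr 1
        ext z
        simp only [mem_product, mem_filter]
        tauto
      simp only [h2]
      rw [← card_biUnion]
      · refine card_le_card fun z hz => ?_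
        simp only [mem_biUnion, mem_filter] at hz ⊢
        obtain ⟨t, ht, hz, h3, h4⟩ := hz
        refine ⟨hz, ?_, ?_, h3.trans h4.symm⟩
        · rintro rfl
          rw [sub_self, zero_pow hM.ne'] at h3
          exact h0 (h3 ▸ ht)
        · rintro rfl
          rw [sub_self, zero_pow hM.ne'] at h4
          exact h0 (h4 ▸ ht)
      · intro t _ t' _ htt
        refine Finset.disjoint_left.2 fun z hz hz' => htt ?_
        exact (mem_filter.1 hz).2.1.symm.trans (mem_filter.1 hz').2.1
    have h3 : ∀ z ∈ C ×ˢ C, #{x : K | x ≠ z.1 ∧ x ≠ z.2 ∧ (x - z.1) ^ M = (x - z.2) ^ M} ≤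
        (if z.1 = z.2 then Fintype.card K else 0) + M := by
      rintro ⟨y, y'⟩ _
      dsimp only
      split_ifs with h
      · exact (card_le_univ _).trans (Nat.le_add_right _ _)
      · rw [zero_add]
        have hroots : #(nthRootsFinset M (1 : K)) ≤ M := by
          rw [nthRootsFinset_def]
          exact (Multiset.toFinset_card_le _).trans (card_nthRoots M 1)
        refine le_trans ?_ hroots
        -- For y ≠ y' this fractional linear map is injective and sends the counted x to M-th roots
        -- of unity. This elementary second moment replaces character sums.
        refine card_le_card_of_injOn (fun x => (x - y) / (x - y')) ?_ ?_
        · intro x hx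
          simp only [coe_filter, mem_univ, true_and, Set.mem_ofPred_eq] at hx
          rw [mem_coe, mem_nthRootsFinset hM, div_pow, hx.2.2,
            div_self (pow_ne_zero _ (sub_ne_zero.2 hx.2.1))]
        · intro x hx x' hx' hxx
          simp only [coe_filter, mem_univ, true_and, Set.mem_ofPred_eq] at hx hx'
          dsimp only at hxx
          rw [div_eq_div_iff (sub_ne_zero.2 hx.2.1) (sub_ne_zero.2 hx'.2.1)] at hxx
          have h4 : (y - y') * (x - x') = 0 := by linear_combination hxx
          rcases mul_eq_zero.1 h4 with h4 | h4
          · exact absurd (sub_eq_zero.1 h4) h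
          · exact sub_eq_zero.1 h4
    have h4 := h1.trans (sum_le_sum h3)
    rw [sum_add_distrib, sum_product] at h4
    simp only [sum_ite_eq, sum_const, card_product, smul_eq_mul, ← sum_filter, filter_mem_eq_inter,
      inter_self] at h4
    have h5 : ((∑ x : K, ∑ t ∈ Λ, #{y ∈ C | (x - y) ^ M = t} ^ 2 : ℕ) : ℝ) ≤
        ((#C * Fintype.card K + #C * #C * M : ℕ) : ℝ) := by
      exact_mod_cast h4
    push_cast at h5
    rw [sq (#C : ℝ)]
    exact h5
  -- The term -|C| comes from y = x, whose difference 0 lies in no class.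
  have hlin : ∑ x : K, ∑ t ∈ Λ, (#{y ∈ C | (x - y) ^ M = t} : ℝ) = #C * Q - #C := by
    have h1 : ∀ x : K, ∑ t ∈ Λ, (#{y ∈ C | (x - y) ^ M = t} : ℝ) =
        #C - if x ∈ C then 1 else 0 := by
      intro x
      have h2 : ∑ t ∈ Λ, #{y ∈ C | (x - y) ^ M = t} = #(C.erase x) := by
        rw [← card_biUnion]
        · congr 1
          ext y
          simp only [mem_biUnion, mem_filter, mem_erase]
          constructor
          · rintro ⟨t, ht, hy, h⟩
            refine ⟨?_, hy⟩
            rintro rfl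
            rw [sub_self, zero_pow hM.ne'] at h
            exact h0 (h ▸ ht)
          · rintro ⟨hne, hy⟩
            exact ⟨_, pow_mem_nthRootsFinset hN hMN (sub_ne_zero.2 hne.symm), hy, rfl⟩
        · intro t _ t' _ htt
          refine Finset.disjoint_left.2 fun z hz hz' => htt ?_
          exact (mem_filter.1 hz).2.symm.trans (mem_filter.1 hz').2
      rw [← Nat.cast_sum, h2]
      split_ifs with hx
      · rw [card_erase_of_mem hx, Nat.cast_sub (card_pos.2 ⟨x, hx⟩)]; simp
      · rw [erase_eq_of_notMem hx]; simp
    simp only [h1, sum_sub_distrib, sum_const, card_univ, nsmul_eq_mul, sum_ite_mem, univ_inter]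
    rw [hQ]; ring
  have hexp : ∑ x : K, ∑ t ∈ Λ, ((#{y ∈ C | (x - y) ^ M = t} : ℝ) - #C / N) ^ 2 =
      ∑ x : K, ∑ t ∈ Λ, (#{y ∈ C | (x - y) ^ M = t} : ℝ) ^ 2 -
        2 * (#C / N) * ∑ x : K, ∑ t ∈ Λ, (#{y ∈ C | (x - y) ^ M = t} : ℝ) +
        Q * (N * (#C / N) ^ 2) := by
    have h1 : Q * (N * (#C / N : ℝ) ^ 2) = ∑ x : K, ∑ t ∈ Λ, (#C / N : ℝ) ^ 2 := by
      simp [hΛ, hQ]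
    rw [h1]
    simp only [mul_sum, ← sum_sub_distrib, ← sum_add_distrib]
    refine sum_congr rfl fun x _ => sum_congr rfl fun t _ => ?_
    ring
  rw [hexp, hlin]
  have h1 : (#C : ℝ) ^ 2 * M = #C ^ 2 / N * (Q - 1) := by
    rw [← hQ1]; field_simp
  have h2 : Q * (N * (#C / N : ℝ) ^ 2) = #C ^ 2 / N * Q := by
    field_simp
  have h3 : 2 * (#C / N : ℝ) * (#C * Q - #C) = 2 * (#C ^ 2 / N) * (Q - 1) := by
    field_simp
  have h4 : (#C : ℝ) ^ 2 / N ≤ #C * Q := by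
    rw [div_le_iff₀ hN']
    have : (1 : ℝ) ≤ N := by exact_mod_cast hN
    have h5 : (#C : ℝ) ^ 2 ≤ #C * Q := by rw [sq]; gcongr
    exact h5.trans (le_mul_of_one_le_right (by positivity) this)
  rw [h2, h3]
  rw [h1] at hsq
  have : (0 : ℝ) ≤ (#C : ℝ) ^ 2 / N := by positivity
  linarith

/-- Only few translates of `C` have few elements in a given class of power residues. -/
lemma card_filter_mul_card_le (hM : 0 < M) (hN : 0 < N) (hMN : M * N = Fintype.card K - 1)
    (C : Finset K) {t : K} (ht : t ∈ nthRootsFinset N (1 : K)) :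
    (#{x : K | 2 * N * #{y ∈ C | (x - y) ^ M = t} < #C} : ℝ) * #C ≤
      12 * N ^ 2 * Fintype.card K := by
  have hN' : (0 : ℝ) < N := by exact_mod_cast hN
  rcases (Nat.zero_le #C).eq_or_lt with hC | hC
  · rw [← hC]; simp; positivity
  have hC' : (0 : ℝ) < #C := by exact_mod_cast hC
  set B : Finset K := {x : K | 2 * N * #{y ∈ C | (x - y) ^ M = t} < #C}
  -- Chebyshev's inequality: at a bad x the count deviates from its mean |C|/N by at least half of
  -- that mean.
  have h1 : #B • ((#C : ℝ) / (2 * N)) ^ 2 ≤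
      ∑ x ∈ B, ((#{y ∈ C | (x - y) ^ M = t} : ℝ) - #C / N) ^ 2 := by
    refine card_nsmul_le_sum _ _ _ fun x hx => ?_
    have hx : 2 * N * (#{y ∈ C | (x - y) ^ M = t} : ℝ) < #C := by
      exact_mod_cast (mem_filter.1 hx).2
    have h2 : (#{y ∈ C | (x - y) ^ M = t} : ℝ) ≤ #C / (2 * N) := by
      rw [le_div_iff₀ (by positivity)]; linarith
    have h3 : (#C : ℝ) / N = 2 * (#C / (2 * N)) := by field_simp
    have h4 : (0 : ℝ) < #C / (2 * N) := by positivity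
    rw [← neg_sq (_ - _)]
    refine pow_le_pow_left₀ h4.le ?_ 2
    linarith
  have h2 : ∑ x ∈ B, ((#{y ∈ C | (x - y) ^ M = t} : ℝ) - #C / N) ^ 2 ≤
      ∑ x : K, ∑ t ∈ nthRootsFinset N (1 : K),
        ((#{y ∈ C | (x - y) ^ M = t} : ℝ) - #C / N) ^ 2 := by
    refine (sum_le_univ_sum_of_nonneg fun _ => sq_nonneg _).trans (sum_le_sum fun x _ => ?_)
    exact single_le_sum (f := fun t => ((#{y ∈ C | (x - y) ^ M = t} : ℝ) - #C / N) ^ 2)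
      (fun _ _ => sq_nonneg _) ht
  have h3 := (h1.trans h2).trans (sum_sum_sq_card_filter_sub_le hM hN hMN C)
  rw [nsmul_eq_mul, div_pow, mul_div_assoc', div_le_iff₀ (by positivity)] at h3
  have h4 : (#B * #C : ℝ) * #C ≤ (12 * N ^ 2 * Fintype.card K) * #C := by
    linarith
  exact le_of_mul_le_mul_right h4 hC'

/-- In large finite fields, points with prescribed classes of power residues of their
differences can be found in prescribed dense sets. -/
theorem exists_forall_sub_pow_eq_of_dense (hN : 0 < N) (k : ℕ) {δ : ℝ} (hδ : 0 < δ) :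
    ∃ Q₀ : ℕ, ∀ (K : Type) [Field K] [Fintype K] [DecidableEq K] (M : ℕ), 0 < M →
      M * N = Fintype.card K - 1 → Q₀ ≤ Fintype.card K → ∀ C : Fin k → Finset K,
      (∀ i, δ * Fintype.card K ≤ #(C i)) → ∀ T : Fin k → Fin k → K,
      (∀ i j, T i j ∈ nthRootsFinset N (1 : K)) →
      ∃ x : Fin k → K, (∀ i, x i ∈ C i) ∧ ∀ i j, i < j → (x i - x j) ^ M = T i j := by
  induction k generalizing δ with
  | zero => exact ⟨0, fun K _ _ _ M _ _ _ C _ T _ => ⟨fun i => i.elim0, fun i => i.elim0,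
      fun i => i.elim0⟩⟩
  | succ k ih =>
    have hN' : (0 : ℝ) < N := by exact_mod_cast hN
    -- Greedy choice: a point of `C 0` outside all bad sets leaves at least a fraction 1/(2N) of
    -- each remaining set. `Q₂` ensures that the bad sets cannot cover `C 0`.
    obtain ⟨Q₁, hQ₁⟩ := ih (δ := δ / (2 * N)) (by positivity)
    obtain ⟨Q₂, hQ₂⟩ := exists_nat_gt (k * (12 * N ^ 2 / δ) / δ)
    refine ⟨max Q₁ Q₂, fun K _ _ _ M hM hMN hQ C hC T hT => ?_⟩
    have hQ0 : (0 : ℝ) < Fintype.card K := by exact_mod_cast Fintype.card_pos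
    let B : Fin k → Finset K := fun j =>
      {x : K | 2 * N * #{y ∈ C j.succ | (x - y) ^ M = T 0 j.succ} < #(C j.succ)}
    have hB : ∀ j, (#(B j) : ℝ) ≤ 12 * N ^ 2 / δ := by
      intro j
      have h := card_filter_mul_card_le hM hN hMN (C j.succ) (hT 0 j.succ)
      rw [le_div_iff₀ hδ]
      have h2 : (#(B j) : ℝ) * (δ * Fintype.card K) ≤ #(B j) * #(C j.succ) := by
        gcongr; exact hC _
      exact le_of_mul_le_mul_right (by linarith) hQ0
    have hcard : #(univ.biUnion B) < #(C 0) := by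
      have h1 : (#(univ.biUnion B) : ℝ) ≤ k * (12 * N ^ 2 / δ) := by
        calc (#(univ.biUnion B) : ℝ) ≤ ∑ j, (#(B j) : ℝ) := by exact_mod_cast card_biUnion_le
          _ ≤ ∑ _j : Fin k, (12 * N ^ 2 / δ : ℝ) := sum_le_sum fun j _ => hB j
          _ = _ := by simp
      have h2 : k * (12 * N ^ 2 / δ) < Fintype.card K * δ := by
        rw [← div_lt_iff₀ hδ]
        refine hQ₂.trans_le ?_
        exact_mod_cast (le_max_right Q₁ Q₂).trans hQ
      have h3 := hC 0
      have h4 : (#(univ.biUnion B) : ℝ) < #(C 0) := by linarith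
      exact_mod_cast h4
    obtain ⟨x₀, hx₀, hxB⟩ := exists_mem_notMem_of_card_lt_card hcard
    have hxB' : ∀ j : Fin k, #(C j.succ) ≤
        2 * N * #{y ∈ C j.succ | (x₀ - y) ^ M = T 0 j.succ} := by
      intro j
      by_contra! h
      exact hxB (mem_biUnion.2 ⟨j, mem_univ j, by simpa [B] using h⟩)
    obtain ⟨x, hxC, hx⟩ := hQ₁ K M hM hMN ((le_max_left Q₁ Q₂).trans hQ)
      (fun j => {y ∈ C j.succ | (x₀ - y) ^ M = T 0 j.succ}) (fun j => by
        have h1 : (#(C j.succ) : ℝ) ≤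
            2 * N * #{y ∈ C j.succ | (x₀ - y) ^ M = T 0 j.succ} := by exact_mod_cast hxB' j
        have h2 := hC j.succ
        rw [div_mul_eq_mul_div, div_le_iff₀ (by positivity)]
        linarith)
      (fun i j => T i.succ j.succ) (fun i j => hT _ _)
    refine ⟨Fin.cons x₀ x, fun i => ?_, fun i j => ?_⟩
    · refine Fin.cases ?_ (fun i => ?_) i
      · simpa using hx₀
      · simpa using (mem_filter.1 (hxC i)).1
    · refine Fin.cases ?_ (fun i => ?_) i <;> refine Fin.cases ?_ (fun j => ?_) j
      · simp
      · intro _; simpa using (mem_filter.1 (hxC j)).2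
      · intro h; exact absurd h (Fin.not_lt_zero _)
      · intro h; simpa using hx i j (Fin.succ_lt_succ_iff.1 h)

/-- In large finite fields, every oriented graph is realized by points whose differences along the
arcs have prescribed classes of power residues. -/
theorem exists_injective_forall_sub_pow_eq (V : Type*) [Finite V] (hN : 0 < N) :
    ∃ Q₀ : ℕ, ∀ (K : Type) [Field K] [Fintype K] [DecidableEq K] (M : ℕ), 0 < M →
      M * N = Fintype.card K - 1 → Q₀ ≤ Fintype.card K → ∀ D : V → V → Prop,
      (∀ u v, D u v → ¬ D v u) → ∀ T : V → V → K,
      (∀ u v, T u v ∈ nthRootsFinset N (1 : K)) →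
      ∃ x : V → K, Function.Injective x ∧ ∀ u v, D u v → (x u - x v) ^ M = T u v := by
  classical
  obtain ⟨k, ⟨e⟩⟩ := Finite.exists_equiv_fin V
  obtain ⟨Q₀, hQ₀⟩ := exists_forall_sub_pow_eq_of_dense hN k one_pos
  refine ⟨Q₀, fun K _ _ _ M hM hMN hQ D hD T hT => ?_⟩
  have hneg : ∀ t ∈ nthRootsFinset N (1 : K), (-1) ^ M * t ∈ nthRootsFinset N (1 : K) := by
    intro t ht
    have h1 := pow_mem_nthRootsFinset hN hMN (z := (-1 : K)) (by simp)
    rw [mem_nthRootsFinset hN] at ht h1 ⊢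
    rw [mul_pow, h1, ht, one_mul]
  obtain ⟨x, -, hx⟩ := hQ₀ K M hM hMN hQ (fun _ => univ) (by simp)
    -- An arc against the order of indices is prescribed through its negative, which multiplies the
    -- class by (-1)^M. Pairs without arc get an arbitrary class, which still forces distinct
    -- points.
    (fun i j => if D (e.symm i) (e.symm j) then T (e.symm i) (e.symm j)
      else (-1) ^ M * T (e.symm j) (e.symm i))
    (fun i j => by
      split_ifs
      · exact hT _ _
      · exact hneg _ (hT _ _))
  have hne : ∀ i j, i < j → x i ≠ x j := by
    intro i j hij h
    have h1 := hx i j hij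
    rw [h, sub_self, zero_pow hM.ne'] at h1
    have h2 : (0 : K) ∉ nthRootsFinset N (1 : K) := by
      rw [mem_nthRootsFinset hN, zero_pow hN.ne']; exact zero_ne_one
    apply h2
    rw [h1]
    split_ifs
    · exact hT _ _
    · exact hneg _ (hT _ _)
  refine ⟨x ∘ e, ?_, fun u v huv => ?_⟩
  · refine Function.Injective.comp (fun i j hij => ?_) e.injective
    rcases lt_trichotomy i j with h | h | h
    · exact absurd hij (hne _ _ h)
    · exact h
    · exact absurd hij.symm (hne _ _ h)
  · rcases lt_trichotomy (e u) (e v) with h | h | h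
    · have := hx _ _ h
      simpa [huv] using this
    · rw [e.injective h] at huv
      exact absurd huv (hD _ _ huv)
    · have := hx _ _ h
      simp only [Equiv.symm_apply_apply, hD _ _ huv, if_false] at this
      rw [Function.comp_apply, Function.comp_apply, ← neg_sub, neg_pow, this, ← mul_assoc,
        ← mul_pow]
      simp

end PowerResidues

namespace SimpleGraph

/-! ### Lower bound: packing complete multipartite graphs -/

section Packing

open Finset Function Classical

variable {V W X Θ : Type*}

/-- A family of edge-disjoint maps of `F` into a `p`-partite graph on at most `n` vertices gives a
lower bound for the multicolor Turán number of graphs that are not `p`-colourable. -/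
lemma card_le_multicolorTuranNumber [Fintype Θ] {F : SimpleGraph V} {G : SimpleGraph W} {p n : ℕ}
    (hF : F.edgeSet.Nonempty) (hp : 0 < p) (hG : ¬ G.Colorable p) (f : Θ → V → X)
    (hf : ∀ θ, Injective (f θ))
    (hdisj : ∀ θ θ' u v u' v', F.Adj u v → F.Adj u' v' → f θ u = f θ' u' → f θ v = f θ' v' →
      θ = θ')
    (π : X → Fin p) (hπ : ∀ θ u v, F.Adj u v → π (f θ u) ≠ π (f θ v)) (ι : X ↪ Fin n) :
    Fintype.card Θ ≤ F.multicolorTuranNumber n G := by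
  let c : Θ → Copy F (⊤ : SimpleGraph (Fin n)) := fun θ =>
    ⟨⟨fun v => ι (f θ v), fun {u v} huv => fun h => huv.ne (hf θ (ι.injective h))⟩,
      fun u v h => hf θ (ι.injective h)⟩
  have hadj : ∀ θ a b, (c θ).toSubgraph.Adj a b →
      ∃ u v, F.Adj u v ∧ ι (f θ u) = a ∧ ι (f θ v) = b := by
    intro θ a b h
    obtain ⟨u, v, huv, h1, h2⟩ := h
    exact ⟨u, v, huv, h1, h2⟩
  have hcommon : ∀ θ θ' a b, (c θ).toSubgraph.Adj a b → (c θ').toSubgraph.Adj a b → θ = θ' := by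
    intro θ θ' a b h h'
    obtain ⟨u, v, huv, rfl, rfl⟩ := hadj _ _ _ h
    obtain ⟨u', v', huv', h1, h2⟩ := hadj _ _ _ h'
    exact hdisj θ θ' u v u' v' huv huv' (ι.injective h1.symm) (ι.injective h2.symm)
  have hinj : Injective fun θ => (c θ).toSubgraph := by
    intro θ θ' h
    obtain ⟨e, he⟩ := hF
    induction e using Sym2.ind with
    | _ u v =>
      have h1 : (c θ).toSubgraph.Adj (ι (f θ u)) (ι (f θ v)) := ⟨u, v, he, rfl, rfl⟩
      exact hcommon θ θ' _ _ h1 (by dsimp only at h; rw [← h]; exact h1)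
  refine le_csSup ⟨Fintype.card (⊤ : SimpleGraph (Fin n)).Subgraph, ?_⟩
    ⟨univ.image fun θ => (c θ).toSubgraph, ⟨?_, ?_⟩, ?_, ?_⟩
  · rintro m ⟨P, -, -, rfl⟩
    exact card_le_univ P
  · intro A hA
    obtain ⟨θ, -, rfl⟩ := mem_image.1 hA
    exact ⟨(c θ).isoToSubgraph⟩
  · intro A hA B hB hAB
    obtain ⟨θ, -, rfl⟩ := mem_image.1 hA
    obtain ⟨θ', -, rfl⟩ := mem_image.1 hB
    refine Set.disjoint_left.2 fun e h h' => hAB ?_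
    induction e using Sym2.ind with
    | _ a b => rw [hcommon θ θ' a b h h']
  · rintro ⟨φ, C, -, hC⟩
    -- The classes would colour G properly. The colour off the range of `ι` is immaterial, as no
    -- edge of the packing ends there.
    refine hG ⟨Coloring.mk (fun w => extend ι π (fun _ => ⟨0, hp⟩) (φ w)) fun {w w'} hw => ?_⟩
    obtain ⟨h1, h2⟩ := hC ⟨s(w, w'), hw⟩
    obtain ⟨θ, -, hθ⟩ := mem_image.1 h1
    rw [← hθ, Sym2.map_mk, Subgraph.mem_edgeSet] at h2
    obtain ⟨u, v, huv, h3, h4⟩ := hadj _ _ _ h2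
    rw [← h3, ← h4, ι.injective.extend_apply, ι.injective.extend_apply]
    exact hπ θ u v huv
  · rw [card_image_of_injective _ hinj, card_univ]

noncomputable instance Coloring.fintypeOfFintype {ι : Type*} [Fintype V] [Fintype ι]
    (F : SimpleGraph V) : Fintype (F.Coloring ι) :=
  Fintype.ofInjective (fun κ : F.Coloring ι => (κ : V → ι)) DFunLike.coe_injective

/-- The coloured arcs of `F` from colour `i` to colour `j`, over all proper colourings. -/
noncomputable def coloredArcs [Fintype V] (F : SimpleGraph V) {p : ℕ} (i j : Fin p) :
    Finset (F.Coloring (Fin p) × V × V) :=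
  {z | F.Adj z.2.1 z.2.2 ∧ z.1 z.2.1 = i ∧ z.1 z.2.2 = j}

lemma card_coloredArcs_le [Fintype V] (F : SimpleGraph V) {p : ℕ} {i j i' j' : Fin p} (h : i ≠ j)
    (h' : i' ≠ j') : #(F.coloredArcs i j) ≤ #(F.coloredArcs i' j') := by
  -- Colours are permuted so that (i, j) becomes (i', j'): the second swap corrects the image of j
  -- and fixes i'.
  let τ : Equiv.Perm (Fin p) := (Equiv.swap i i').trans (Equiv.swap (Equiv.swap i i' j) j')
  have hi : τ i = i' := by
    have h1 : Equiv.swap i i' j ≠ i' := fun h2 => by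
      have := Equiv.swap_apply_left i i'
      exact h ((Equiv.swap i i').injective (this.trans h2.symm))
    simp only [τ, Equiv.trans_apply, Equiv.swap_apply_left]
    exact Equiv.swap_apply_of_ne_of_ne h1.symm h'
  have hj : τ j = j' := by simp [τ]
  refine card_le_card_of_injOn (fun z => (Coloring.mk (fun v => τ (z.1 v)) fun {u v} huv h2 =>
    z.1.valid huv (τ.injective h2), z.2.1, z.2.2)) ?_ ?_
  · rintro ⟨κ, u, v⟩ hz
    simp only [coloredArcs, coe_filter, mem_univ, true_and, Set.mem_ofPred_eq] at hz ⊢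
    obtain ⟨h1, h2, h3⟩ := hz
    refine ⟨h1, ?_, ?_⟩
    · change τ (κ u) = i'; rw [h2, hi]
    · change τ (κ v) = j'; rw [h3, hj]
  · rintro ⟨κ, u, v⟩ _ ⟨κ', u', v'⟩ _ h2
    obtain ⟨h3, h4⟩ := Prod.mk.inj h2
    refine Prod.ext (DFunLike.ext _ _ fun w => τ.injective ?_) h4
    exact DFunLike.congr_fun h3 w

/-- By symmetry in the colours, the arcs of all colourings distribute evenly over the p² - p ordered
pairs of distinct colours. -/
lemma mul_card_coloredArcs [Fintype V] (F : SimpleGraph V) {p : ℕ} {i j : Fin p} (h : i ≠ j) :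
    (p * p - p) * #(F.coloredArcs i j) =
      Fintype.card (F.Coloring (Fin p)) * (2 * F.edgeSet.ncard) := by
  have h1 : ∀ z ∈ (univ : Finset (Fin p)).offDiag, #(F.coloredArcs z.1 z.2) =
      #(F.coloredArcs i j) := fun z hz =>
    le_antisymm (F.card_coloredArcs_le (mem_offDiag.1 hz).2.2 h)
      (F.card_coloredArcs_le h (mem_offDiag.1 hz).2.2)
  have h2 : #(univ : Finset (Fin p)).offDiag = p * p - p := by simp
  rw [← h2, ← smul_eq_mul, ← sum_const, ← sum_congr rfl h1, ← card_biUnion, ← card_adj_pairs,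
    ← card_univ (α := F.Coloring (Fin p)), ← card_product]
  · congr 1
    ext ⟨κ, u, v⟩
    simp only [coloredArcs, mem_biUnion, mem_offDiag, mem_univ, true_and, mem_filter, mem_product]
    constructor
    · rintro ⟨_, _, h, _⟩
      exact h
    · intro h
      exact ⟨(κ u, κ v), κ.valid h, h, rfl, rfl⟩
  · rintro z _ z' _ hzz
    refine Finset.disjoint_left.2 fun w hw hw' => hzz ?_
    obtain ⟨-, h3, h4⟩ := (mem_filter.1 hw).2
    obtain ⟨-, h5, h6⟩ := (mem_filter.1 hw').2
    exact Prod.ext (h3.symm.trans h5) (h4.symm.trans h6)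

lemma exists_injOn_forall_mem {α β : Type*} {s : Finset α} {t : Finset β} (h : #s ≤ #t)
    (ht : t.Nonempty) : ∃ f : α → β, (∀ a, f a ∈ t) ∧ Set.InjOn f s := by
  obtain ⟨y, hy⟩ := ht
  obtain ⟨g⟩ := Function.Embedding.nonempty_of_card_le (α := s) (β := t) (by simpa using h)
  refine ⟨fun a => if ha : a ∈ s then g ⟨a, ha⟩ else y, fun a => ?_, fun a ha b hb hab => ?_⟩
  · dsimp only
    split_ifs with ha
    · exact (g ⟨a, ha⟩).2
    · exact hy
  · rw [mem_coe] at ha hb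
    simp only [ha, hb, dif_pos] at hab
    simpa using g.injective (Subtype.ext hab)

/-- If `m` is congruent to `1` modulo `|V|!`, then `V` embeds into `ZMod m` with invertible
differences. -/
lemma exists_forall_isUnit_sub (V : Type*) [Fintype V] {m : ℕ}
    (hm : ∃ j, m = (Fintype.card V).factorial * j + 1) :
    ∃ z : V → ZMod m, ∀ u v, u ≠ v → IsUnit (z u - z v) := by
  obtain ⟨j, hj⟩ := hm
  let e := Fintype.equivFin V
  have key : ∀ u v, e u < e v → IsUnit (((e v : ℕ) : ZMod m) - ((e u : ℕ) : ZMod m)) := by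
    intro u v huv
    have huv' : (e u : ℕ) < e v := huv
    rw [← Nat.cast_sub huv'.le, ZMod.isUnit_iff_coprime]
    have hdvd : (e v : ℕ) - e u ∣ (Fintype.card V).factorial :=
      Nat.dvd_factorial (by omega) (by have := (e v).2; omega)
    refine Nat.Coprime.coprime_dvd_left hdvd ?_
    rw [hj]
    simp
  refine ⟨fun v => ((e v : ℕ) : ZMod m), fun u v huv => ?_⟩
  rcases lt_trichotomy (e u) (e v) with h | h | h
  · rw [← neg_sub]; exact (key u v h).neg
  · exact absurd (e.injective h) huv
  · exact key v u h

/-- Packings of the complete balanced `p`-partite graph by a `p`-colourable graph `F`. -/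
theorem card_packing_le_multicolorTuranNumber [Fintype V] {F : SimpleGraph V} {G : SimpleGraph W}
    {p : ℕ} (hF : F.edgeSet.Nonempty) (hp : 2 ≤ p) (hFp : F.Colorable p) (hG : ¬ G.Colorable p)
    (Q₁ : ℕ) : ∃ Q > Q₁, ∀ m n j : ℕ, m = (Fintype.card V).factorial * j + 1 → p * Q * m ≤ n →
      (p * p - p) * (Q * (Q - 1)) * m ^ 2 ≤
        2 * F.edgeSet.ncard * F.multicolorTuranNumber n G := by
  set i₀ : Fin p := ⟨0, by omega⟩
  set i₁ : Fin p := ⟨1, by omega⟩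
  have h01 : i₀ ≠ i₁ := by simp [i₀, i₁]
  set N := #(F.coloredArcs i₀ i₁) with hN
  have hNeq := F.mul_card_coloredArcs h01
  have hNle : ∀ i j : Fin p, i ≠ j → #(F.coloredArcs i j) ≤ N := fun i j h =>
    F.card_coloredArcs_le h h01
  have he : 0 < F.edgeSet.ncard := (Set.ncard_pos (Set.toFinite _)).2 hF
  have hN0 : 0 < N := by
    refine Nat.pos_of_ne_zero fun h => ?_
    rw [← hN, h, mul_zero] at hNeq
    have : 0 < Fintype.card (F.Coloring (Fin p)) := Fintype.card_pos_iff.2 hFp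
    have : 0 < Fintype.card (F.Coloring (Fin p)) * (2 * F.edgeSet.ncard) := by positivity
    omega
  obtain ⟨Q₀, hQ₀⟩ := exists_injective_forall_sub_pow_eq V hN0
  obtain ⟨Q, hQp, hQgt, hQN⟩ := Nat.exists_prime_gt_modEq_one (max Q₁ Q₀) hN0.ne'
  have : Fact Q.Prime := ⟨hQp⟩
  obtain ⟨M, hM⟩ : N ∣ Q - 1 := (Nat.modEq_iff_dvd' hQp.one_lt.le).1 hQN.symm
  have hMN : M * N = Fintype.card (ZMod Q) - 1 := by rw [ZMod.card, hM, mul_comm]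
  have hM0 : 0 < M := by
    refine Nat.pos_of_ne_zero fun h => ?_
    have := hQp.one_lt
    rw [h, mul_zero] at hM
    omega
  refine ⟨Q, (le_max_left _ _).trans_lt hQgt, fun m n j hm hmn => ?_⟩
  have : NeZero m := ⟨by omega⟩
  set Λ := Polynomial.nthRootsFinset N (1 : ZMod Q)
  have hΛ : #Λ = N := card_nthRootsFinset_of_mul_eq hMN
  set A := Polynomial.nthRootsFinset M (1 : ZMod Q)
  have hA : #A = M := card_nthRootsFinset_of_mul_eq (by rw [mul_comm]; exact hMN)
  -- There are exactly as many residue classes as coloured arcs between two classes, so arcs can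
  -- receive distinct labels; for i = j the labels are a dummy.
  have hlabel : ∀ i j : Fin p, ∃ l : F.Coloring (Fin p) × V × V → ZMod Q,
      (∀ a, l a ∈ Λ) ∧ (i ≠ j → Set.InjOn l (F.coloredArcs i j)) := by
    intro i j
    have hΛne : Λ.Nonempty := card_pos.1 (by omega)
    by_cases hij : i = j
    · exact ⟨fun _ => hΛne.choose, fun _ => hΛne.choose_spec, fun h => absurd hij h⟩
    · obtain ⟨l, h1, h2⟩ := exists_injOn_forall_mem ((hNle i j hij).trans hΛ.ge) hΛne
      exact ⟨l, h1, fun _ => h2⟩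
  choose l hlΛ hlinj using hlabel
  have hpos : ∀ κ : F.Coloring (Fin p), ∃ x : V → ZMod Q, Injective x ∧
      ∀ u v, F.Adj u v ∧ κ u < κ v → (x u - x v) ^ M = l (κ u) (κ v) (κ, u, v) := fun κ =>
    hQ₀ (ZMod Q) M hM0 hMN (by rw [ZMod.card]; exact ((le_max_right _ _).trans_lt hQgt).le)
      (fun u v => F.Adj u v ∧ κ u < κ v) (fun u v h h' => lt_asymm h.2 h'.2)
      (fun u v => l (κ u) (κ v) (κ, u, v)) (fun u v => hlΛ _ _ _)
  choose x hxinj hx using hpos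
  obtain ⟨z, hz⟩ := exists_forall_isUnit_sub V ⟨j, hm⟩
  have hApow : ∀ a : A, (a : ZMod Q) ^ M = 1 := fun a =>
    (Polynomial.mem_nthRootsFinset hM0 1).1 a.2
  have hA0 : ∀ a : A, (a : ZMod Q) ≠ 0 := by
    intro a h
    have := hApow a
    rw [h, zero_pow hM0.ne'] at this
    exact zero_ne_one this
  -- Scaling by `a` in `A` preserves residue classes. An edge thus reveals its label, hence κ, u and
  -- v; its two ends then determine a and b, and, since `z u - z v` is a unit, also α and β.
  let f : F.Coloring (Fin p) × A × ZMod Q × ZMod m × ZMod m → V → Fin p × ZMod Q × ZMod m :=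
    fun θ v => (θ.1 v, θ.2.1 * x θ.1 v + θ.2.2.1, θ.2.2.2.1 * z v + θ.2.2.2.2)
  have hfinj : ∀ θ, Injective (f θ) := by
    rintro ⟨κ, a, b, α, β⟩ u v h
    have h1 : (a : ZMod Q) * x κ u + b = a * x κ v + b := congrArg (fun y => y.2.1) h
    exact hxinj κ (mul_left_cancel₀ (hA0 a) (add_right_cancel h1))
  have hlt : ∀ θ θ' u v u' v', F.Adj u v → F.Adj u' v' → f θ u = f θ' u' → f θ v = f θ' v' →
      θ.1 u < θ.1 v → θ = θ' := by
    rintro ⟨κ, a, b, α, β⟩ ⟨κ', a', b', α', β'⟩ u v u' v' huv huv' hu hv hκ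
    dsimp only at hκ
    have hcu : κ u = κ' u' := congrArg (fun y => y.1) hu
    have hcv : κ v = κ' v' := congrArg (fun y => y.1) hv
    have hKu : (a : ZMod Q) * x κ u + b = a' * x κ' u' + b' := congrArg (fun y => y.2.1) hu
    have hKv : (a : ZMod Q) * x κ v + b = a' * x κ' v' + b' := congrArg (fun y => y.2.1) hv
    have hZu : α * z u + β = α' * z u' + β' := congrArg (fun y => y.2.2) hu
    have hZv : α * z v + β = α' * z v' + β' := congrArg (fun y => y.2.2) hv
    have hdiff : (a : ZMod Q) * (x κ u - x κ v) = a' * (x κ' u' - x κ' v') := by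
      linear_combination hKu - hKv
    have hlab : l (κ u) (κ v) (κ, u, v) = l (κ u) (κ v) (κ', u', v') := by
      have h1 := congrArg (· ^ M) hdiff
      simp only [mul_pow, hApow, one_mul] at h1
      rw [hx κ u v ⟨huv, hκ⟩, hx κ' u' v' ⟨huv', by rwa [← hcu, ← hcv]⟩, ← hcu, ← hcv] at h1
      exact h1
    have heq := hlinj (κ u) (κ v) hκ.ne (by simp [coloredArcs, huv])
      (by simp [coloredArcs, huv', hcu, hcv]) hlab
    simp only [Prod.mk.injEq] at heq
    obtain ⟨rfl, rfl, rfl⟩ := heq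
    have hxne : x κ u - x κ v ≠ 0 := sub_ne_zero.2 fun h => huv.ne (hxinj κ h)
    have haa : a = a' := Subtype.ext (mul_right_cancel₀ hxne hdiff)
    subst haa
    have hbb : b = b' := add_left_cancel hKu
    have hαα : α = α' := by
      have h1 : α * (z u - z v) = α' * (z u - z v) := by linear_combination hZu - hZv
      exact (hz u v huv.ne).mul_right_cancel h1
    subst hαα
    have hββ : β = β' := add_left_cancel hZu
    rw [hbb, hββ]
  have hfdisj : ∀ θ θ' u v u' v', F.Adj u v → F.Adj u' v' → f θ u = f θ' u' → f θ v = f θ' v' →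
      θ = θ' := by
    intro θ θ' u v u' v' huv huv' hu hv
    rcases lt_or_gt_of_ne (θ.1.valid huv) with h | h
    · exact hlt θ θ' u v u' v' huv huv' hu hv h
    · exact hlt θ θ' v u v' u' huv.symm huv'.symm hv hu h
  obtain ⟨ι⟩ : Nonempty (Fin p × ZMod Q × ZMod m ↪ Fin n) := by
    refine Function.Embedding.nonempty_of_card_le ?_
    simpa [ZMod.card, mul_assoc] using hmn
  have hcard := card_le_multicolorTuranNumber hF (by omega) hG f hfinj hfdisj (fun y => y.1)
    (fun θ u v huv => θ.1.valid huv) ι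
  have hΘ : Fintype.card (F.Coloring (Fin p) × A × ZMod Q × ZMod m × ZMod m) =
      Fintype.card (F.Coloring (Fin p)) * (M * (Q * (m * m))) := by
    simp [ZMod.card, hA]
  rw [hΘ] at hcard
  -- MN = Q - 1 makes the packing use as many edges as there are between distinct classes with
  -- distinct `ZMod Q` coordinates.
  calc (p * p - p) * (Q * (Q - 1)) * m ^ 2
      = ((p * p - p) * N) * (M * (Q * (m * m))) := by rw [hM]; ring
    _ = 2 * F.edgeSet.ncard * (Fintype.card (F.Coloring (Fin p)) * (M * (Q * (m * m)))) := by
        rw [hNeq]; ring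
    _ ≤ _ := Nat.mul_le_mul_left _ hcard

/-- The packings of balanced complete `p`-partite graphs are asymptotically perfect. -/
theorem eventually_le_multicolorTuranNumber [Finite V] {F : SimpleGraph V} {G : SimpleGraph W}
    {p : ℕ} (hF : F.edgeSet.Nonempty) (hp : 2 ≤ p) (hFp : F.Colorable p) (hG : ¬ G.Colorable p)
    {ε : ℝ} (hε : 0 < ε) : ∀ᶠ n : ℕ in atTop, (1 - 1 / (p : ℝ) - ε) * (n : ℝ) ^ 2 ≤
      2 * (F.edgeSet.ncard : ℝ) * F.multicolorTuranNumber n G := by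
  have := Fintype.ofFinite V
  obtain ⟨Q₁, hQ₁⟩ := exists_nat_gt (2 / ε)
  obtain ⟨Q, hQ, hpack⟩ := card_packing_le_multicolorTuranNumber hF hp hFp hG Q₁
  set s := (Fintype.card V).factorial
  have hs : 0 < s := Nat.factorial_pos _
  have hQ0 : 0 < Q := by omega
  have hp0 : 0 < p := by omega
  obtain ⟨n₀, hn₀⟩ := exists_nat_gt (4 * (p * Q * s : ℕ) / ε)
  filter_upwards [eventually_ge_atTop n₀, eventually_ge_atTop (p * Q * s),
    eventually_ge_atTop (p * Q)] with n hn hn' hn''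
  -- Q depends on ε but not on n; m is the largest admissible size, so fewer than the constant pQs
  -- vertices remain unused.
  set j := (n - p * Q) / (p * Q * s)
  have hc : 0 < p * Q * s := by positivity
  have h1 : p * Q * s * j ≤ n - p * Q := Nat.mul_div_le _ _
  have h2 : n - p * Q < p * Q * s * (j + 1) := by
    have := Nat.lt_mul_div_succ (n - p * Q) hc
    exact this
  have hmn : p * Q * (s * j + 1) ≤ n := by
    have : p * Q * (s * j + 1) = p * Q * s * j + p * Q := by ring
    omega
  have hmn' : n ≤ p * Q * (s * j + 1) + p * Q * s := by
    have e1 : p * Q * (s * j + 1) = p * Q * s * j + p * Q := by ring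
    have e2 : p * Q * s * (j + 1) = p * Q * s * j + p * Q * s := by ring
    omega
  have hmain := hpack (s * j + 1) n j rfl hmn
  set m := s * j + 1
  have hpR : (2 : ℝ) ≤ p := by exact_mod_cast hp
  have hQR : (0 : ℝ) < Q := by exact_mod_cast hQ0
  have hmain' : ((p : ℝ) * p - p) * (Q * (Q - 1)) * (m : ℝ) ^ 2 ≤
      2 * (F.edgeSet.ncard : ℝ) * F.multicolorTuranNumber n G := by
    have h : (((p * p - p) * (Q * (Q - 1)) * m ^ 2 : ℕ) : ℝ) ≤
        ((2 * F.edgeSet.ncard * F.multicolorTuranNumber n G : ℕ) : ℝ) := by exact_mod_cast hmain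
    rw [Nat.cast_mul, Nat.cast_mul, Nat.cast_sub (Nat.le_mul_self p), Nat.cast_mul Q,
      Nat.cast_sub hQ0] at h
    push_cast at h ⊢
    exact h
  refine le_trans ?_ hmain'
  set L : ℝ := ((p * Q * s : ℕ) : ℝ) with hL
  have hnL : L ≤ n := by rw [hL]; exact_mod_cast hn'
  have hmR : (n : ℝ) - L ≤ p * Q * m := by
    have : (n : ℝ) ≤ ((p * Q * m + p * Q * s : ℕ) : ℝ) := by exact_mod_cast hmn'
    rw [Nat.cast_add, ← hL] at this
    push_cast at this
    linarith
  have hL0 : 0 ≤ L := by positivity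
  have hsq : (n : ℝ) ^ 2 - 2 * L * n ≤ (p * Q * m) ^ 2 := by
    have h3 : ((n : ℝ) - L) ^ 2 ≤ (p * Q * m) ^ 2 :=
      pow_le_pow_left₀ (by linarith) hmR 2
    nlinarith [sq_nonneg L]
  have hLn : 2 * L * n ≤ ε / 2 * (n : ℝ) ^ 2 := by
    have h3 : 4 * L / ε < n := hn₀.trans_le (by exact_mod_cast hn)
    rw [div_lt_iff₀ hε] at h3
    have h4 : (0 : ℝ) ≤ n := by positivity
    nlinarith
  have hQε : 1 / (Q : ℝ) ≤ ε / 2 := by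
    have h3 : 2 / ε < Q := hQ₁.trans (by exact_mod_cast hQ)
    rw [div_lt_iff₀ hε] at h3
    rw [div_le_iff₀ hQR]
    linarith
  have hcoef : ((p : ℝ) * p - p) * (Q * (Q - 1)) * (m : ℝ) ^ 2 =
      (1 - 1 / (p : ℝ)) * (1 - 1 / Q) * (p * Q * m) ^ 2 := by
    have : (p : ℝ) ≠ 0 := by positivity
    field_simp
  have hp1 : 0 ≤ 1 - 1 / (p : ℝ) := by
    rw [sub_nonneg, div_le_one (by linarith)]; linarith
  have hp2 : 1 - 1 / (p : ℝ) ≤ 1 := by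
    have : (0 : ℝ) ≤ 1 / p := by positivity
    linarith
  have hQ1 : 0 ≤ 1 - 1 / (Q : ℝ) := by
    rw [sub_nonneg, div_le_one hQR]; exact_mod_cast hQ0
  have hQ2 : 1 - 1 / (Q : ℝ) ≤ 1 := by
    have : (0 : ℝ) ≤ 1 / Q := by positivity
    linarith
  rw [hcoef]
  set c := (1 - 1 / (p : ℝ)) * (1 - 1 / Q) with hcdef
  have hc0 : 0 ≤ c := mul_nonneg hp1 hQ1
  have hc1 : c ≤ 1 := mul_le_one₀ hp2 hQ1 hQ2
  have hc2 : 1 - 1 / (p : ℝ) - ε / 2 ≤ c := by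
    have : c = 1 - 1 / (p : ℝ) - (1 - 1 / (p : ℝ)) * (1 / Q) := by rw [hcdef]; ring
    have h3 : (1 - 1 / (p : ℝ)) * (1 / Q) ≤ 1 * (ε / 2) := by gcongr
    linarith
  calc (1 - 1 / (p : ℝ) - ε) * (n : ℝ) ^ 2
      = (1 - 1 / (p : ℝ) - ε / 2) * (n : ℝ) ^ 2 - ε / 2 * (n : ℝ) ^ 2 := by ring
    _ ≤ c * (n : ℝ) ^ 2 - 1 * (2 * L * n) := by
        rw [one_mul]; gcongr
    _ ≤ c * (n : ℝ) ^ 2 - c * (2 * L * n) := by gcongr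
    _ = c * ((n : ℝ) ^ 2 - 2 * L * n) := by ring
    _ ≤ c * (p * Q * m) ^ 2 := by gcongr

end Packing

end SimpleGraph

/-! ### Assembling the asymptotic equivalence -/

namespace SimpleGraph

/-- The second alternative covers an empty set of sizes, whose supremum is 0 by convention. -/
lemma exists_card_eq_multicolorTuranNumber_or_eq_zero {V W : Type*} (F : SimpleGraph V) (n : ℕ)
    (G : SimpleGraph W) :
    (∃ P : Finset (⊤ : SimpleGraph (Fin n)).Subgraph, F.IsEdgeDisjointCopies P ∧
      ¬ G.HasRainbowCopy P ∧ P.card = F.multicolorTuranNumber n G) ∨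
      F.multicolorTuranNumber n G = 0 := by
  classical
  set s := {m : ℕ | ∃ P : Finset (⊤ : SimpleGraph (Fin n)).Subgraph,
    F.IsEdgeDisjointCopies P ∧ ¬ G.HasRainbowCopy P ∧ P.card = m} with hs
  have hmem : F.multicolorTuranNumber n G = sSup s := rfl
  rcases s.eq_empty_or_nonempty with h | h
  · right
    rw [hmem, h, csSup_empty]
    rfl
  · left
    rw [hmem]
    refine Nat.sSup_mem h ⟨Fintype.card (⊤ : SimpleGraph (Fin n)).Subgraph, ?_⟩
    rintro m ⟨P, -, -, rfl⟩
    exact Finset.card_le_univ P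

/-- The upper bounds on packings, for the multicolor Turán number. -/
theorem eventually_multicolorTuranNumber_le {V W : Type*} [Finite V] [Finite W] [Nonempty W]
    (F : SimpleGraph V) (G : SimpleGraph W) {q : ℕ} (hG : G.Colorable (q + 2)) {ε : ℝ}
    (hε : 0 < ε) : ∀ᶠ n : ℕ in atTop,
      2 * (F.edgeSet.ncard : ℝ) * F.multicolorTuranNumber n G ≤
        (1 - 1 / (q + 1 : ℝ) + ε) * (n : ℝ) ^ 2 ∧
      (¬ F.Colorable (q + 1) → 2 * ((F.edgeSet.ncard : ℝ) + 1) * F.multicolorTuranNumber n G ≤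
        (1 - 1 / (q + 1 : ℝ) + ε) * (n : ℝ) ^ 2) := by
  filter_upwards [eventually_card_packing_le F G hG hε] with n hn
  rcases F.exists_card_eq_multicolorTuranNumber_or_eq_zero n G with ⟨P, hP, hGP, hcard⟩ | h
  · rw [← hcard]
    exact hn P hP hGP
  · have h0 : (0 : ℝ) ≤ (1 - 1 / (q + 1 : ℝ) + ε) * (n : ℝ) ^ 2 := by
      have : 1 / (q + 1 : ℝ) ≤ 1 := by
        rw [div_le_one (by positivity)]
        linarith [(Nat.cast_nonneg q : (0 : ℝ) ≤ q)]
      exact mul_nonneg (by linarith) (sq_nonneg _)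
    rw [h, Nat.cast_zero, mul_zero, mul_zero]
    exact ⟨h0, fun _ => h0⟩

end SimpleGraph

theorem corollary1p12 {V W : Type*} [Finite V] [Finite W]
    (F : SimpleGraph V) (G : SimpleGraph W)
    (hF : F.edgeSet.Nonempty) (hG : 3 ≤ G.chromaticNumber) :
    ((fun n : ℕ => (F.multicolorTuranNumber n G : ℝ) -
        ((G.chromaticNumber.toNat : ℝ) - 2) /
          (2 * (F.edgeSet.ncard : ℝ) * ((G.chromaticNumber.toNat : ℝ) - 1)) * (n : ℝ) ^ 2)
      =o[atTop] (fun n : ℕ => (n : ℝ) ^ 2)) ↔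
    F.chromaticNumber < G.chromaticNumber := by
  have := Fintype.ofFinite W
  obtain ⟨r, hr⟩ : ∃ r : ℕ, G.chromaticNumber = r :=
    ⟨_, (ENat.natCast_toNat (SimpleGraph.chromaticNumber_ne_top_iff_exists.2
      ⟨_, G.colorable_of_fintype⟩)).symm⟩
  have hr3 : 3 ≤ r := by rw [hr] at hG; exact_mod_cast hG
  obtain ⟨q, rfl⟩ : ∃ q, r = q + 2 := ⟨r - 2, by omega⟩
  have hGc : G.Colorable (q + 2) := SimpleGraph.chromaticNumber_le_iff_colorable.1 hr.le
  have hGnc : ¬ G.Colorable (q + 1) := by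
    rw [← SimpleGraph.chromaticNumber_le_iff_colorable, hr]
    exact not_le.2 (by exact_mod_cast Nat.lt_succ_self (q + 1))
  have : Nonempty W := by
    by_contra h
    rw [not_nonempty_iff] at h
    exact hGnc (.of_isEmpty _)
  have hFG : F.chromaticNumber < G.chromaticNumber ↔ F.Colorable (q + 1) := by
    rw [← SimpleGraph.chromaticNumber_le_iff_colorable, hr]
    have : ((q + 2 : ℕ) : ℕ∞) = ((q + 1 : ℕ) : ℕ∞) + 1 := by push_cast; rfl
    rw [this, ENat.lt_add_one_iff (ENat.natCast_ne_top _)]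
  have hq : (1 : ℝ) ≤ q := by exact_mod_cast (by omega : 1 ≤ q)
  have he : (0 : ℝ) < F.edgeSet.ncard := by
    exact_mod_cast (Set.ncard_pos (Set.toFinite _)).2 hF
  rw [hFG, hr, ENat.toNat_natCast]
  set e : ℝ := (F.edgeSet.ncard : ℝ) with he'
  set k : ℝ := (((q + 2 : ℕ) : ℝ) - 2) / (2 * e * (((q + 2 : ℕ) : ℝ) - 1)) with hk
  have hk2 : 2 * e * k = 1 - 1 / (q + 1 : ℝ) := by
    have h1 : ((q + 2 : ℕ) : ℝ) - 1 = q + 1 := by push_cast; ring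
    have h2 : ((q + 2 : ℕ) : ℝ) - 2 = q := by push_cast; ring
    rw [hk, h1, h2]
    field_simp
    ring
  have hk0 : 0 < k := by
    have h1 : (0 : ℝ) < 1 - 1 / (q + 1 : ℝ) := by
      rw [sub_pos, div_lt_one (by positivity)]; linarith
    rw [← hk2] at h1
    exact (mul_pos_iff_of_pos_left (by positivity)).1 h1
  constructor
  · intro ho
    by_contra hFc
    -- After multiplication by 2(e+1), the asymptotic formula exceeds the improved upper bound by
    -- 2kn², while the two errors, each (k/2)n², total only kn².
    have hc : 0 < k / (4 * (e + 1)) := by positivity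
    obtain ⟨n, ⟨h1, -, h2⟩, h3⟩ := (((isLittleO_iff.1 ho hc).and
      (SimpleGraph.eventually_multicolorTuranNumber_le F G hGc (half_pos hk0))).and
      (eventually_gt_atTop 0)).exists
    replace h2 := h2 hFc
    have hn : (0 : ℝ) < (n : ℝ) ^ 2 := by positivity
    rw [Real.norm_eq_abs, Real.norm_of_nonneg hn.le] at h1
    have h4 := (abs_le.1 h1).1
    rw [← hk2] at h2
    have h5 : 2 * (e + 1) * (k / (4 * (e + 1)) * (n : ℝ) ^ 2) = k / 2 * (n : ℝ) ^ 2 := by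
      field_simp
      ring
    have h6 : 2 * (e + 1) * (k * (n : ℝ) ^ 2 - k / (4 * (e + 1)) * (n : ℝ) ^ 2) ≤
        2 * (e + 1) * F.multicolorTuranNumber n G := by
      gcongr
      linarith
    have h7 : 0 < k * (n : ℝ) ^ 2 := by positivity
    linarith
  · intro hFc
    refine isLittleO_iff.2 fun c hc => ?_
    have hε : 0 < 2 * e * c := by positivity
    filter_upwards [SimpleGraph.eventually_multicolorTuranNumber_le F G hGc hε,
      SimpleGraph.eventually_le_multicolorTuranNumber hF (by omega) hFc hGnc hε] with n hu hl
    have hu := hu.1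
    push_cast at hl
    rw [← hk2] at hu hl
    rw [Real.norm_eq_abs, Real.norm_of_nonneg (sq_nonneg _), abs_le]
    have he2 : 0 < 2 * e := by positivity
    constructor
    · refine le_of_mul_le_mul_left ?_ he2
      linarith
    · refine le_of_mul_le_mul_left ?_ he2
      linarith
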